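/- Let $N\in\mathbb N$, $1<p<N$, $\gamma>1$ and $p^*=\frac{pN}{N-p}$. Let $\mathcal D^{1,p}(\mathbb R^N)$ be the completion of $C_c^\infty(\mathbb R^N)$ (real-valued functions) in the norm $\|\nabla u\|_{L^p}$, realized by the Sobolev inequality as a space of functions $u\in L^{p^*}(\mathbb R^N)$ with weak gradient in $L^p$, and let $X=\mathcal D^{1,p}_{\mathrm{rad}}(\mathbb R^N)$ be its closed subspace of radial functions (functions that agree almost everywhere with a function of $|x|$), with the same norm. Let $$D=\Big\{\,g_j\;:\;j\in\mathbb Z\Big\},\qquad (g_ju)(x)=\gamma^{j}\,u\big(\gamma^{\frac{pj}{N-p}}x\big),$$ a group of linear isometries of $X$. A sequence $(u_k)$ in $X$ is said to converge to zero $D$-weakly if, for every sequence $(h_k)$ in $D$, $h_ku_k\rightharpoonup 0$ weakly in $X$. Then the limiting Sobolev embedding $X\hookrightarrow L^{p^*}(\mathbb R^N)$ (a continuous linear injection) is cocompact relative to $D$, that is, for every sequence $(u_k)$ in $X$, $$u_k\to 0\ \ D\text{-weakly}\quad\Longrightarrow\quad \|u_k\|_{L^{p^*}}\to 0 .$$ Moreover,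 the $L^{p^*}$-norm metrizes $D$-weak convergence on bounded sets: for every sequence $(u_k)$ that is bounded in $X$, $$u_k\to 0\ \ D\text{-weakly}\quad\Longleftrightarrow\quad \|u_k\|_{L^{p^*}}\to 0 .$$ -/

import Mathlib

open MeasureTheory Filter Topology
open scoped ENNReal NNReal ContDiff

noncomputable section

namespace Cocompact

/-! ### Gauged weak convergence, cocompactness, metrization -/

section Gauge

variable {X Y : Type*} [NormedAddCommGroup X] [NormedSpace ℝ X] [CompleteSpace X]
  [NormedAddCommGroup Y] [NormedSpace ℝ Y] [CompleteSpace Y]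

/-- A bounded set of bounded linear operators on a Banach space `X` that contains the identity. -/
structure GaugeSet (X : Type*) [NormedAddCommGroup X] [NormedSpace ℝ X] where
  carrier : Set (X →L[ℝ] X)
  id_mem : ContinuousLinearMap.id ℝ X ∈ carrier
  isBounded : Bornology.IsBounded carrier

/-- `u k` converges to zero `D`-weakly: `g k (u k)` converges to zero weakly in `X` for every
choice of a sequence `g` of operators in `D`. -/
def GaugedWeakNull (D : GaugeSet X) (u : ℕ → X) : Prop :=
  ∀ g : ℕ → (X →L[ℝ] X), (∀ k, g k ∈ D.carrier) →
    Tendsto (fun k => toWeakSpace ℝ X (g k (u k))) atTop (𝓝 0)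

/-- The continuous linear embedding `i` of `X` into `Y` is cocompact relative to `D`. -/
def IsCocompactEmbedding (D : GaugeSet X) (i : X →L[ℝ] Y) : Prop :=
  Function.Injective i ∧
    ∀ u : ℕ → X, GaugedWeakNull D u → Tendsto (fun k => ‖i (u k)‖) atTop (𝓝 0)

/-- The norm of `Y` provides a local metrization of the `D`-weak convergence on `X`: on bounded
sequences of `X`, `D`-weak convergence to zero is the same as convergence to zero in `Y`. -/
def NormMetrizesGaugedWeak (D : GaugeSet X) (i : X →L[ℝ] Y) : Prop :=
  ∀ u : ℕ → X, Bornology.IsBounded (Set.range u) →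
    (GaugedWeakNull D u ↔ Tendsto (fun k => ‖i (u k)‖) atTop (𝓝 0))

end Gauge

/-! ### Dilation of `L^q` functions -/

section Dilate

variable {N : ℕ} {F : Type*} [NormedAddCommGroup F]

/-- The Euclidean space `ℝ^N`. -/
abbrev Euc (N : ℕ) : Type := EuclideanSpace ℝ (Fin N)

theorem quasiMeasurePreserving_smul {t : ℝ} (ht : t ≠ 0) :
    Measure.QuasiMeasurePreserving (fun x : Euc N => t • x) volume volume := by
  refine ⟨measurable_const_smul t, ?_⟩
  rw [Measure.map_addHaar_smul _ ht]
  exact Measure.smul_absolutelyContinuous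

theorem eLpNorm_comp_smul {t : ℝ} (ht : 0 < t) (q : ℝ≥0∞) {f : Euc N → F}
    (hf : AEStronglyMeasurable f volume) :
    eLpNorm (fun x => f (t • x)) q volume
      = ENNReal.ofReal ((t ^ N)⁻¹ ^ q.toReal⁻¹) * eLpNorm f q volume := by
  have hmap := Measure.map_addHaar_smul (volume : Measure (Euc N)) ht.ne'
  have hpos : 0 < (t ^ N)⁻¹ := by positivity
  rw [finrank_euclideanSpace_fin, abs_of_pos hpos] at hmap
  have h := eLpNorm_map_measure (p := q) (μ := (volume : Measure (Euc N))) (g := f)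
    (f := fun x : Euc N => t • x) (by rw [hmap]; exact hf.smul_measure _)
    (measurable_const_smul t).aemeasurable
  rw [hmap, eLpNorm_smul_measure_of_ne_zero (by simpa using hpos)] at h
  rw [show (fun x => f (t • x)) = f ∘ fun x : Euc N => t • x from rfl, ← h, smul_eq_mul,
    one_div, ENNReal.toReal_inv, ENNReal.ofReal_rpow_of_pos hpos]

theorem memLp_comp_smul {t : ℝ} (ht : 0 < t) {q : ℝ≥0∞} {f : Euc N → F}
    (hf : MemLp f q volume) : MemLp (fun x => f (t • x)) q volume := by
  refine ⟨hf.1.comp_quasiMeasurePreserving (quasiMeasurePreserving_smul ht.ne'), ?_⟩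
  rw [eLpNorm_comp_smul ht q hf.1]
  exact ENNReal.mul_lt_top ENNReal.ofReal_lt_top hf.2

variable [NormedSpace ℝ F]

/-- The operator `f ↦ a f(t ·)` on `L^q(ℝ^N; F)`, for `t > 0`, as a linear map. -/
def lpDilateLin (F : Type*) [NormedAddCommGroup F] [NormedSpace ℝ F] (q : ℝ≥0∞)
    (a : ℝ) {t : ℝ} (ht : 0 < t) :
    Lp F q (volume : Measure (Euc N)) →ₗ[ℝ] Lp F q (volume : Measure (Euc N)) where
  toFun f := a • (memLp_comp_smul ht (Lp.memLp f)).toLp _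
  map_add' f g := by
    rw [← smul_add]
    congr 1
    rw [← MemLp.toLp_add, MemLp.toLp_eq_toLp_iff]
    exact (quasiMeasurePreserving_smul ht.ne').ae_eq (Lp.coeFn_add f g)
  map_smul' c f := by
    rw [RingHom.id_apply, smul_comm c a]
    congr 1
    rw [← MemLp.toLp_const_smul, MemLp.toLp_eq_toLp_iff]
    exact (quasiMeasurePreserving_smul ht.ne').ae_eq (Lp.coeFn_smul c f)

theorem lpDilateLin_coeFn (q : ℝ≥0∞) (a : ℝ) {t : ℝ} (ht : 0 < t)
    (f : Lp F q (volume : Measure (Euc N))) :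
    lpDilateLin F q a ht f =ᵐ[volume] fun x => a • f (t • x) := by
  filter_upwards [Lp.coeFn_smul a ((memLp_comp_smul ht (Lp.memLp f)).toLp _),
    (memLp_comp_smul ht (Lp.memLp f)).coeFn_toLp] with x h1 h2
  rw [← h2]
  exact h1

theorem norm_lpDilateLin (q : ℝ≥0∞) [Fact (1 ≤ q)] (a : ℝ) {t : ℝ} (ht : 0 < t)
    (f : Lp F q (volume : Measure (Euc N))) :
    ‖lpDilateLin F q a ht f‖ = |a| * (t ^ N)⁻¹ ^ q.toReal⁻¹ * ‖f‖ := by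
  change ‖a • (memLp_comp_smul ht (Lp.memLp f)).toLp _‖ = _
  rw [norm_smul, Lp.norm_toLp, eLpNorm_comp_smul ht q (Lp.aestronglyMeasurable f),
    ENNReal.toReal_mul, ENNReal.toReal_ofReal (by positivity), Real.norm_eq_abs, mul_assoc,
    Lp.norm_def]

/-- The bounded operator `f ↦ a f(t ·)` on `L^q(ℝ^N; F)`, for `t > 0`. -/
def lpDilate (F : Type*) [NormedAddCommGroup F] [NormedSpace ℝ F] (q : ℝ≥0∞) [Fact (1 ≤ q)]
    (a : ℝ) {t : ℝ} (ht : 0 < t) :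
    Lp F q (volume : Measure (Euc N)) →L[ℝ] Lp F q (volume : Measure (Euc N)) :=
  (lpDilateLin F q a ht).mkContinuous (|a| * (t ^ N)⁻¹ ^ q.toReal⁻¹)
    fun f => (norm_lpDilateLin q a ht f).le

end Dilate

/-! ### The space `D^{1,p}(ℝ^N)` -/

section Space

/-- The critical exponent `p* = pN/(N-p)`. -/
def critExp (N : ℕ) (p : ℝ) : ℝ := p * N / (N - p)

variable (N : ℕ) (p : ℝ) [Fact (1 < p)] [Fact (p < N)]

instance factOneLeOfReal (p : ℝ) [h : Fact (1 < p)] : Fact (1 ≤ ENNReal.ofReal p) :=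
  ⟨by simpa using h.out.le⟩

instance factOneLtCritExp (N : ℕ) (p : ℝ) [h : Fact (1 < p)] [h' : Fact (p < N)] : Fact (1 < critExp N p) :=
  ⟨by
    have h1 := h.out
    have h2 := h'.out
    rw [critExp, lt_div_iff₀ (by linarith)]
    nlinarith⟩

/-- The target space `L^{p*}(ℝ^N)`. -/
abbrev LCrit : Type := Lp ℝ (ENNReal.ofReal (critExp N p)) (volume : Measure (Euc N))

/-- The space `L^p` of gradient fields; covectors carry the dual of the Euclidean norm, so that
`‖fderiv ℝ φ x‖ = |∇φ(x)|`. -/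
abbrev LGrad : Type := Lp (Euc N →L[ℝ] ℝ) (ENNReal.ofReal p) (volume : Measure (Euc N))

/-- The pairs `(φ, ∇φ)` with `φ ∈ C_c^∞(ℝ^N)`. -/
def testGraph : Submodule ℝ (LCrit N p × LGrad N p) where
  carrier := {w | ∃ φ : Euc N → ℝ, ContDiff ℝ ∞ φ ∧ HasCompactSupport φ ∧
    w.1 =ᵐ[volume] φ ∧ w.2 =ᵐ[volume] fderiv ℝ φ}
  zero_mem' := by
    refine ⟨0, contDiff_const, HasCompactSupport.zero, Lp.coeFn_zero _ _ _, ?_⟩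
    have : fderiv ℝ (0 : Euc N → ℝ) = 0 := by
      ext1 x
      exact fderiv_const_apply 0
    rw [this]
    exact Lp.coeFn_zero _ _ _
  add_mem' := by
    rintro v w ⟨φ, h1, h2, h3, h4⟩ ⟨ψ, k1, k2, k3, k4⟩
    refine ⟨φ + ψ, h1.add k1, h2.add k2, (Lp.coeFn_add _ _).trans (h3.add k3),
      (Lp.coeFn_add _ _).trans ?_⟩
    filter_upwards [h4, k4] with x a b
    rw [Pi.add_apply, a, b, fderiv_add (h1.differentiable (by simp) x)
      (k1.differentiable (by simp) x)]
  smul_mem' := by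
    rintro c w ⟨φ, h1, h2, h3, h4⟩
    refine ⟨c • φ, h1.const_smul c, h2.smul_left (f := fun _ => c),
      (Lp.coeFn_smul _ _).trans (h3.const_smul c), (Lp.coeFn_smul _ _).trans ?_⟩
    filter_upwards [h4] with x a
    rw [Pi.smul_apply, a, fderiv_const_smul (h1.differentiable (by simp) x)]

/-- Every test function belongs to the space. -/
theorem exists_mem_testGraph {φ : Euc N → ℝ} (h : ContDiff ℝ ∞ φ) (hc : HasCompactSupport φ) :
    ∃ w ∈ testGraph N p, w.1 =ᵐ[volume] φ ∧ w.2 =ᵐ[volume] fderiv ℝ φ := by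
  have h1 : MemLp φ (ENNReal.ofReal (critExp N p)) volume :=
    h.continuous.memLp_of_hasCompactSupport hc
  have h2 : MemLp (fderiv ℝ φ) (ENNReal.ofReal p) volume :=
    (h.continuous_fderiv (by simp)).memLp_of_hasCompactSupport (hc.fderiv ℝ)
  exact ⟨(h1.toLp, h2.toLp), ⟨φ, h, hc, h1.coeFn_toLp, h2.coeFn_toLp⟩,
    h1.coeFn_toLp, h2.coeFn_toLp⟩

/-- The limiting Sobolev inequality, extended to the closure by density. -/
theorem exists_sobolev_const : ∃ C : ℝ≥0, ∀ w ∈ (testGraph N p).topologicalClosure,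
    ‖w.1‖ ≤ C * ‖w.2‖ := by
  have h1 : 1 < p := Fact.out
  have h2 : p < N := Fact.out
  refine ⟨SNormLESNormFDerivOfEqConst ℝ (volume : Measure (Euc N)) p.toNNReal, ?_⟩
  have hcl : IsClosed {w : LCrit N p × LGrad N p | ‖w.1‖ ≤
      SNormLESNormFDerivOfEqConst ℝ (volume : Measure (Euc N)) p.toNNReal * ‖w.2‖} :=
    isClosed_le (by fun_prop) (by fun_prop)
  refine fun w hw => closure_minimal ?_ hcl hw
  rintro w ⟨φ, hφ, hc, e1, e2⟩
  have hs : 0 < critExp N p := zero_lt_one.trans (factOneLtCritExp N p).out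
  have key := eLpNorm_le_eLpNorm_fderiv_of_eq (volume : Measure (Euc N))
    (hφ.of_le (by simp)) hc (p := p.toNNReal) (p' := (critExp N p).toNNReal)
    (by simpa using h1.le) (by
      rw [finrank_euclideanSpace_fin]
      have : (0 : ℝ) < N := by linarith
      exact_mod_cast this)
    (by
      rw [NNReal.coe_inv, Real.coe_toNNReal _ hs.le, Real.coe_toNNReal _ (by linarith),
        finrank_euclideanSpace_fin, critExp]
      have : (N : ℝ) - p ≠ 0 := by linarith
      have : (N : ℝ) ≠ 0 := by linarith
      have : p ≠ 0 := by linarith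
      field_simp)
  rw [← eLpNorm_congr_ae e1, ← eLpNorm_congr_ae e2] at key
  change ‖w.1‖ ≤ _ * ‖w.2‖
  rw [Lp.norm_def, Lp.norm_def, ← ENNReal.coe_toReal, ← ENNReal.toReal_mul]
  exact ENNReal.toReal_mono (ENNReal.mul_ne_top ENNReal.coe_ne_top (Lp.memLp w.2).2.ne) key

/-- The space `D^{1,p}(ℝ^N)`, the completion of `C_c^∞(ℝ^N)` in the gradient norm `‖∇u‖_{L^p}`.
An element is a pair `(u, ∇u)`, with `u ∈ L^{p*}` and `∇u ∈ L^p`, that is a limit in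
`L^{p*} × L^p` of pairs `(φ, ∇φ)` with test functions `φ`; by the Sobolev inequality these limits
are exactly the limits of the sequences `φ_n` that are Cauchy in the gradient norm. -/
def D1p : Type := (testGraph N p).topologicalClosure

instance : AddCommGroup (D1p N p) :=
  inferInstanceAs (AddCommGroup (testGraph N p).topologicalClosure)

instance : Module ℝ (D1p N p) :=
  inferInstanceAs (Module ℝ (testGraph N p).topologicalClosure)

variable {N p}

/-- The pair `(u, ∇u)` of an element `u`. -/
def D1p.pair : D1p N p →ₗ[ℝ] LCrit N p × LGrad N p :=
  (testGraph N p).topologicalClosure.subtype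

/-- The function `u ∈ L^{p*}` underlying an element of `D^{1,p}`. -/
def D1p.fn : D1p N p →ₗ[ℝ] LCrit N p := LinearMap.fst ℝ _ _ ∘ₗ D1p.pair

/-- The weak gradient `∇u ∈ L^p` of an element of `D^{1,p}`. -/
def D1p.grad : D1p N p →ₗ[ℝ] LGrad N p := LinearMap.snd ℝ _ _ ∘ₗ D1p.pair

theorem D1p.grad_injective : Function.Injective (D1p.grad : D1p N p →ₗ[ℝ] LGrad N p) := by
  rw [← LinearMap.ker_eq_bot, LinearMap.ker_eq_bot']
  intro u hu
  obtain ⟨C, hC⟩ := exists_sobolev_const N p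
  have h := hC _ (show D1p.pair u ∈ _ from Subtype.property (p := (· ∈ (testGraph N p).topologicalClosure)) u)
  have hu' : (D1p.pair u).2 = 0 := hu
  rw [hu', norm_zero, mul_zero, norm_le_zero_iff] at h
  exact Subtype.ext (Prod.ext h hu')

variable (N p)

/-- The norm of `D^{1,p}` is `‖u‖ = ‖∇u‖_{L^p}`. -/
instance : NormedAddCommGroup (D1p N p) :=
  NormedAddCommGroup.induced (D1p N p) (LGrad N p) D1p.grad D1p.grad_injective

instance : NormedSpace ℝ (D1p N p) :=
  NormedSpace.induced ℝ (D1p N p) (LGrad N p) D1p.grad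

variable {N p}

theorem D1p.norm_def (u : D1p N p) : ‖u‖ = ‖D1p.grad u‖ := rfl

variable (N p)

theorem exists_norm_fn_le : ∃ C : ℝ, ∀ u : D1p N p, ‖D1p.fn u‖ ≤ C * ‖u‖ := by
  obtain ⟨C, hC⟩ := exists_sobolev_const N p
  exact ⟨C, fun u => hC _ (Subtype.property (p := (· ∈ (testGraph N p).topologicalClosure)) u)⟩

/-- The limiting Sobolev embedding `D^{1,p}(ℝ^N) → L^{p*}(ℝ^N)`. -/
def sobolevEmbedding : D1p N p →L[ℝ] LCrit N p :=
  LinearMap.mkContinuousOfExistsBound (D1p.fn : D1p N p →ₗ[ℝ] LCrit N p) (exists_norm_fn_le N p)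

/-- `D^{1,p}` with the gradient norm is isomorphic to the closed subspace of `L^{p*} × L^p`. -/
def equivClosure : D1p N p ≃L[ℝ] (testGraph N p).topologicalClosure where
  toLinearEquiv := LinearEquiv.refl ℝ (testGraph N p).topologicalClosure
  continuous_toFun := by
    refine Continuous.subtype_mk (f := fun u : D1p N p => (sobolevEmbedding N p u, D1p.grad u)) ?_ _
    exact (sobolevEmbedding N p).continuous.prodMk
      (AddMonoidHomClass.continuous_of_bound D1p.grad 1 fun u => by simp [D1p.norm_def])
  continuous_invFun := by
    refine AddMonoidHomClass.continuous_of_bound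
      (show (testGraph N p).topologicalClosure →ₗ[ℝ] D1p N p from
        (LinearEquiv.refl ℝ (testGraph N p).topologicalClosure).toLinearMap) 1 fun u => ?_
    rw [one_mul]
    exact norm_snd_le u.1

instance : CompleteSpace (D1p N p) :=
  (completeSpace_congr (e := (equivClosure N p).toEquiv)
    (equivClosure N p).isUniformEmbedding).2
      (Submodule.isClosed_topologicalClosure _).completeSpace_coe

/-! ### The radial subspace -/

/-- The radial elements of `D^{1,p}(ℝ^N)`: `u(x)` depends only on `|x|`. -/
def radial : Submodule ℝ (D1p N p) where
  carrier := {u | ∃ f : ℝ → ℝ, sobolevEmbedding N p u =ᵐ[volume] fun x => f ‖x‖}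
  zero_mem' := ⟨0, by rw [map_zero]; exact Lp.coeFn_zero _ _ _⟩
  add_mem' := by
    rintro u v ⟨f, hf⟩ ⟨g, hg⟩
    refine ⟨f + g, ?_⟩
    rw [map_add]
    exact (Lp.coeFn_add _ _).trans (hf.add hg)
  smul_mem' := by
    rintro c u ⟨f, hf⟩
    refine ⟨c • f, ?_⟩
    rw [map_smul]
    exact (Lp.coeFn_smul _ _).trans (hf.const_smul c)

theorem isClosed_radial : IsClosed (radial N p : Set (D1p N p)) := by
  refine isClosed_of_closure_subset fun u hu => ?_
  obtain ⟨v, hv, hlim⟩ := mem_closure_iff_seq_limit.1 hu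
  choose f hf using hv
  obtain ⟨ns, -, hns⟩ := (tendstoInMeasure_of_tendsto_Lp
    (((sobolevEmbedding N p).continuous.tendsto u).comp hlim)).exists_seq_tendsto_ae
  refine ⟨fun r => limUnder atTop fun i => f (ns i) r, ?_⟩
  filter_upwards [hns, ae_all_iff.2 hf] with x hx hfx
  refine (Tendsto.limUnder_eq ?_).symm
  simpa [Function.comp, hfx] using hx

/-- The space `D^{1,p}_rad(ℝ^N)`, with the norm of `D^{1,p}(ℝ^N)`. -/
abbrev D1pRad : Type := radial N p

instance : CompleteSpace (D1pRad N p) := (isClosed_radial N p).completeSpace_coe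

/-- The limiting Sobolev embedding `D^{1,p}_rad(ℝ^N) → L^{p*}(ℝ^N)`. -/
def radialEmbedding : D1pRad N p →L[ℝ] LCrit N p :=
  sobolevEmbedding N p ∘L (radial N p).subtypeL

/-! ### The group of dilations -/

/-- The operator `(u, G) ↦ (a u(t ·), a t G(t ·))` on `L^{p*} × L^p`. -/
def pairDilate (a : ℝ) {t : ℝ} (ht : 0 < t) :
    LCrit N p × LGrad N p →L[ℝ] LCrit N p × LGrad N p :=
  (lpDilate ℝ _ a ht).prodMap (lpDilate (Euc N →L[ℝ] ℝ) _ (a * t) ht)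

theorem pairDilate_mem (a : ℝ) {t : ℝ} (ht : 0 < t) {w : LCrit N p × LGrad N p}
    (hw : w ∈ (testGraph N p).topologicalClosure) :
    pairDilate N p a ht w ∈ (testGraph N p).topologicalClosure := by
  refine map_mem_closure (pairDilate N p a ht).continuous hw ?_
  rintro w ⟨φ, h, hc, e1, e2⟩
  have hq := quasiMeasurePreserving_smul (N := N) ht.ne'
  refine ⟨fun x => a • φ (t • x), ?_, ?_, ?_, ?_⟩
  · exact (h.comp (contDiff_const_smul t)).const_smul a
  · exact (hc.comp_smul ht.ne').smul_left (f := fun _ => a)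
  · filter_upwards [lpDilateLin_coeFn _ a ht w.1, hq.ae e1] with x h1 h2
    rw [← h2]
    exact h1
  · filter_upwards [lpDilateLin_coeFn _ (a * t) ht w.2, hq.ae e2] with x h1 h2
    have hd : HasFDerivAt (fun x : Euc N => a • φ (t • x))
        (a • (fderiv ℝ φ (t • x)).comp (t • ContinuousLinearMap.id ℝ (Euc N))) x :=
      (((h.differentiable (by simp) (t • x)).hasFDerivAt).comp x
        ((hasFDerivAt_id x).const_smul t)).const_smul a
    rw [hd.fderiv, ContinuousLinearMap.comp_smul, ContinuousLinearMap.comp_id, smul_smul, ← h2]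
    exact h1

/-- The operator `u ↦ a u(t ·)` on `D^{1,p}(ℝ^N)`, as a linear map. -/
def dilateLin (a : ℝ) {t : ℝ} (ht : 0 < t) : D1p N p →ₗ[ℝ] D1p N p :=
  (pairDilate N p a ht).toLinearMap.restrict fun _ hw => pairDilate_mem N p a ht hw

theorem norm_dilateLin (a : ℝ) {t : ℝ} (ht : 0 < t) (u : D1p N p) :
    ‖dilateLin N p a ht u‖ = |a * t| * (t ^ N)⁻¹ ^ p⁻¹ * ‖u‖ := by
  have h := norm_lpDilateLin (ENNReal.ofReal p) (a * t) ht (D1p.grad u)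
  rw [ENNReal.toReal_ofReal (zero_lt_one.trans Fact.out).le] at h
  exact h

/-- The operator `u ↦ a u(t ·)` on `D^{1,p}(ℝ^N)`, for `t > 0`. -/
def dilate (a : ℝ) {t : ℝ} (ht : 0 < t) : D1p N p →L[ℝ] D1p N p :=
  (dilateLin N p a ht).mkContinuous _ fun u => (norm_dilateLin N p a ht u).le

theorem dilate_coeFn (a : ℝ) {t : ℝ} (ht : 0 < t) (u : D1p N p) :
    sobolevEmbedding N p (dilate N p a ht u)
      =ᵐ[volume] fun x => a * sobolevEmbedding N p u (t • x) :=
  lpDilateLin_coeFn _ a ht (D1p.fn u)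

theorem dilate_mem_radial (a : ℝ) {t : ℝ} (ht : 0 < t) {u : D1p N p} (hu : u ∈ radial N p) :
    dilate N p a ht u ∈ radial N p := by
  obtain ⟨f, hf⟩ := hu
  refine ⟨fun r => a * f (t * r), ?_⟩
  filter_upwards [dilate_coeFn N p a ht u,
    (quasiMeasurePreserving_smul ht.ne').ae hf] with x h1 h2
  rw [h1, h2, norm_smul, Real.norm_of_nonneg ht.le]

/-- The operator `u ↦ γ^j u(γ^{pj/(N-p)} ·)` on `D^{1,p}_rad(ℝ^N)`. -/
def gauge {γ : ℝ} (hγ : 1 < γ) (j : ℤ) : D1pRad N p →L[ℝ] D1pRad N p :=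
  ((dilate N p (γ ^ j)
      (Real.rpow_pos_of_pos (zero_lt_one.trans hγ) (p * j / (N - p)))).comp
    (radial N p).subtypeL).codRestrict (radial N p) fun u => dilate_mem_radial N p _ _ u.2

theorem gauge_coeFn {γ : ℝ} (hγ : 1 < γ) (j : ℤ) (u : D1pRad N p) :
    radialEmbedding N p (gauge N p hγ j u) =ᵐ[volume]
      fun x => γ ^ j * radialEmbedding N p u (γ ^ (p * j / (N - p)) • x) :=
  dilate_coeFn N p (γ ^ j) (Real.rpow_pos_of_pos (zero_lt_one.trans hγ) (p * j / (N - p))) u.1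

theorem norm_gauge_apply {γ : ℝ} (hγ : 1 < γ) (j : ℤ) (u : D1pRad N p) :
    ‖gauge N p hγ j u‖ = ‖u‖ := by
  have h0 : 0 < γ := zero_lt_one.trans hγ
  have h1 : 1 < p := Fact.out
  have h2 : p < N := Fact.out
  have h := norm_dilateLin N p (γ ^ j) (Real.rpow_pos_of_pos h0 (p * j / (N - p))) u.1
  refine h.trans ?_
  rw [abs_of_pos (by positivity)]
  have : γ ^ j * γ ^ (p * j / (N - p)) * ((γ ^ (p * j / (N - p))) ^ N)⁻¹ ^ p⁻¹ = 1 := by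
    rw [← Real.rpow_intCast, ← Real.rpow_natCast, ← Real.rpow_mul h0.le, ← Real.rpow_neg h0.le,
      ← Real.rpow_mul h0.le, ← Real.rpow_add h0, ← Real.rpow_add h0]
    have hn : (N : ℝ) - p ≠ 0 := by linarith
    have hp : p ≠ 0 := by linarith
    convert Real.rpow_zero γ using 2
    field_simp
    ring
  rw [this, one_mul]
  rfl

theorem gauge_zero {γ : ℝ} (hγ : 1 < γ) :
    gauge N p hγ 0 = ContinuousLinearMap.id ℝ (D1pRad N p) := by
  have ht : γ ^ (p * ((0 : ℤ) : ℝ) / (N - p)) = 1 := by simp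
  ext1 u
  refine Subtype.ext (D1p.grad_injective (Lp.ext ?_))
  have h := lpDilateLin_coeFn (ENNReal.ofReal p) (γ ^ (0 : ℤ) * γ ^ (p * ((0 : ℤ) : ℝ) / (N - p)))
    (Real.rpow_pos_of_pos (zero_lt_one.trans hγ) (p * ((0 : ℤ) : ℝ) / (N - p))) (D1p.grad u.1)
  refine Filter.EventuallyEq.trans h ?_
  filter_upwards with x
  rw [ht, zpow_zero, one_mul, one_smul, one_smul]
  rfl

/-- The group `D = {u ↦ γ^j u(γ^{pj/(N-p)} ·) : j ∈ ℤ}` of operators on `D^{1,p}_rad(ℝ^N)`. -/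
def dilationGroup {γ : ℝ} (hγ : 1 < γ) : GaugeSet (D1pRad N p) where
  carrier := Set.range (gauge N p hγ)
  id_mem := ⟨0, gauge_zero N p hγ⟩
  isBounded := by
    refine (isBounded_iff_forall_norm_le (E := D1pRad N p →L[ℝ] D1pRad N p)).2 ⟨1, ?_⟩
    rintro _ ⟨j, rfl⟩
    refine ContinuousLinearMap.opNorm_le_bound _ zero_le_one fun u => ?_
    rw [norm_gauge_apply, one_mul]

end Space

end Cocompact

end

noncomputable section

namespace Cocompact

section UniformConvexity

variable {F : Type*} [NormedAddCommGroup F] [NormedSpace ℝ F]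

theorem norm_half_add_rpow_lt [StrictConvexSpace ℝ F] {p : ℝ} (hp : 1 < p) {a b : F}
    (hab : a ≠ b) : ‖(1 / 2 : ℝ) • (a + b)‖ ^ p < (‖a‖ ^ p + ‖b‖ ^ p) / 2 := by
  have hp0 : 0 < p := by linarith
  by_cases h : ‖a‖ = ‖b‖
  · have h1 := (norm_midpoint_lt_iff h).2 hab
    calc _ < ‖a‖ ^ p := Real.rpow_lt_rpow (norm_nonneg _) h1 hp0
      _ = _ := by rw [h]; ring
  · have h1 : ‖(1 / 2 : ℝ) • (a + b)‖ ≤ (1 / 2) * ‖a‖ + (1 / 2) * ‖b‖ := by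
      rw [norm_smul, ← mul_add, Real.norm_of_nonneg (by norm_num)]
      gcongr
      exact norm_add_le a b
    have h2 := (strictConvexOn_rpow hp).2 (Set.mem_Ici.2 (norm_nonneg a))
      (Set.mem_Ici.2 (norm_nonneg b)) h (show (0 : ℝ) < 1 / 2 by norm_num)
      (show (0 : ℝ) < 1 / 2 by norm_num) (by norm_num)
    simp only [smul_eq_mul] at h2
    calc _ ≤ ((1 / 2) * ‖a‖ + (1 / 2) * ‖b‖) ^ p :=
          Real.rpow_le_rpow (norm_nonneg _) h1 hp0.le
      _ < _ := h2
      _ = _ := by ring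

theorem norm_half_add_rpow_le [StrictConvexSpace ℝ F] {p : ℝ} (hp : 1 < p) (a b : F) :
    ‖(1 / 2 : ℝ) • (a + b)‖ ^ p ≤ (‖a‖ ^ p + ‖b‖ ^ p) / 2 := by
  by_cases hab : a = b
  · subst hab
    rw [← two_smul ℝ a, smul_smul]
    norm_num
  · exact (norm_half_add_rpow_lt hp hab).le

theorem isCompact_setOf_norm_rpow_add_eq_one [FiniteDimensional ℝ F] {p : ℝ} (hp : 0 < p) :
    IsCompact {x : F × F | ‖x.1‖ ^ p + ‖x.2‖ ^ p = 1} := by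
  have : ProperSpace F := FiniteDimensional.proper ℝ F
  refine Metric.isCompact_of_isClosed_isBounded ?_ ?_
  · refine isClosed_eq ?_ continuous_const
    exact ((continuous_fst.norm).rpow_const fun _ => .inr hp.le).add
      ((continuous_snd.norm).rpow_const fun _ => .inr hp.le)
  · refine isBounded_iff_forall_norm_le.2 ⟨1, fun x hx => ?_⟩
    have hx' : ‖x.1‖ ^ p + ‖x.2‖ ^ p = 1 := hx
    have h1 := Real.rpow_nonneg (norm_nonneg x.1) p
    have h2 := Real.rpow_nonneg (norm_nonneg x.2) p
    refine max_le ?_ ?_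
    · exact (Real.rpow_le_rpow_iff (norm_nonneg _) zero_le_one hp).1 (by
        rw [Real.one_rpow]; linarith)
    · exact (Real.rpow_le_rpow_iff (norm_nonneg _) zero_le_one hp).1 (by
        rw [Real.one_rpow]; linarith)

/-- A quantitative form of the strict convexity of `‖·‖ ^ p`. -/
theorem exists_norm_half_add_rpow_add_le [FiniteDimensional ℝ F] [StrictConvexSpace ℝ F]
    {p : ℝ} (hp : 1 < p) {ε : ℝ} (hε : 0 < ε) :
    ∃ δ > 0, ∀ a b : F, ‖(1 / 2 : ℝ) • (a + b)‖ ^ p + δ * ‖a - b‖ ^ p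
      ≤ (1 / 2 + δ * ε) * (‖a‖ ^ p + ‖b‖ ^ p) := by
  have hp0 : 0 < p := by linarith
  have hunit : ∃ δ > 0, ∀ a b : F, ‖a‖ ^ p + ‖b‖ ^ p = 1 →
      ‖(1 / 2 : ℝ) • (a + b)‖ ^ p + δ * ‖a - b‖ ^ p ≤ 1 / 2 + δ * ε := by
    set K : Set (F × F) := {x | ‖x.1‖ ^ p + ‖x.2‖ ^ p = 1} ∩ {x | ε ≤ ‖x.1 - x.2‖ ^ p}
    have hK : IsCompact K := by
      refine (isCompact_setOf_norm_rpow_add_eq_one hp0).inter_right ?_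
      exact isClosed_le continuous_const
        (((continuous_fst.sub continuous_snd).norm).rpow_const fun _ => .inr hp0.le)
    have hfar : ∃ δ > 0, ∀ x ∈ K,
        ‖(1 / 2 : ℝ) • (x.1 + x.2)‖ ^ p + δ * ‖x.1 - x.2‖ ^ p ≤ 1 / 2 := by
      rcases K.eq_empty_or_nonempty with h | h
      · exact ⟨1, one_pos, by simp [h]⟩
      · obtain ⟨x, hx, hmax⟩ := hK.exists_isMaxOn h
          (f := fun x : F × F => ‖(1 / 2 : ℝ) • (x.1 + x.2)‖ ^ p)
          (((continuous_fst.add continuous_snd).const_smul (1 / 2 : ℝ)).norm.rpow_const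
            fun _ => .inr hp0.le).continuousOn
        have hne : x.1 ≠ x.2 := by
          intro h
          have : ε ≤ ‖x.1 - x.2‖ ^ p := hx.2
          rw [h, sub_self, norm_zero, Real.zero_rpow hp0.ne'] at this
          linarith
        have hlt := norm_half_add_rpow_lt hp hne
        rw [show ‖x.1‖ ^ p + ‖x.2‖ ^ p = 1 from hx.1] at hlt
        obtain ⟨y, hy, hymax⟩ := hK.exists_isMaxOn h
          (f := fun x : F × F => ‖x.1 - x.2‖ ^ p)
          ((continuous_fst.sub continuous_snd).norm.rpow_const fun _ => .inr hp0.le).continuousOn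
        have hypos : 0 < ‖y.1 - y.2‖ ^ p := hε.trans_le hy.2
        refine ⟨(1 / 2 - ‖(1 / 2 : ℝ) • (x.1 + x.2)‖ ^ p) / ‖y.1 - y.2‖ ^ p,
          div_pos (by linarith) hypos, fun z hz => ?_⟩
        have h1 : ‖(1 / 2 : ℝ) • (z.1 + z.2)‖ ^ p ≤ ‖(1 / 2 : ℝ) • (x.1 + x.2)‖ ^ p := hmax hz
        have h2 : ‖z.1 - z.2‖ ^ p ≤ ‖y.1 - y.2‖ ^ p := hymax hz
        have h3 := mul_le_mul_of_nonneg_left h2 (div_pos (by linarith) hypos :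
          0 < (1 / 2 - ‖(1 / 2 : ℝ) • (x.1 + x.2)‖ ^ p) / ‖y.1 - y.2‖ ^ p).le
        rw [div_mul_cancel₀ _ hypos.ne'] at h3
        linarith
    obtain ⟨δ, hδ, h⟩ := hfar
    refine ⟨δ, hδ, fun a b hab => ?_⟩
    by_cases hc : ε ≤ ‖a - b‖ ^ p
    · exact (h (a, b) ⟨hab, hc⟩).trans (by nlinarith)
    · have h1 := norm_half_add_rpow_le hp a b
      rw [hab] at h1
      nlinarith
  obtain ⟨δ, hδ, h⟩ := hunit
  refine ⟨δ, hδ, fun a b => ?_⟩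
  set S := ‖a‖ ^ p + ‖b‖ ^ p with hS
  have ha := Real.rpow_nonneg (norm_nonneg a) p
  have hb := Real.rpow_nonneg (norm_nonneg b) p
  rcases (add_nonneg ha hb).eq_or_lt with h0 | h0
  · have ha0 : a = 0 := by
      have : ‖a‖ ^ p = 0 := by linarith
      simpa [Real.rpow_eq_zero (norm_nonneg a) hp0.ne'] using this
    have hb0 : b = 0 := by
      have : ‖b‖ ^ p = 0 := by linarith
      simpa [Real.rpow_eq_zero (norm_nonneg b) hp0.ne'] using this
    simp [hS, ha0, hb0, Real.zero_rpow hp0.ne']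
  · set c := S ^ (-p⁻¹) with hc
    have hcpos : 0 < c := Real.rpow_pos_of_pos h0 _
    have hcp : c ^ p * S = 1 := by
      rw [hc, ← Real.rpow_mul h0.le, neg_mul, inv_mul_cancel₀ hp0.ne', Real.rpow_neg_one,
        inv_mul_cancel₀ h0.ne']
    have hn : ∀ x : F, ‖c • x‖ ^ p = c ^ p * ‖x‖ ^ p := fun x => by
      rw [norm_smul, Real.norm_of_nonneg hcpos.le, Real.mul_rpow hcpos.le (norm_nonneg _)]
    have key := h (c • a) (c • b) (by rw [hn, hn, ← mul_add]; exact hcp)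
    rw [← smul_add, ← smul_sub, smul_comm, hn, hn] at key
    have hcpp : 0 < c ^ p := Real.rpow_pos_of_pos hcpos _
    refine le_of_mul_le_mul_left ?_ hcpp
    calc _ = c ^ p * ‖(1 / 2 : ℝ) • (a + b)‖ ^ p + δ * (c ^ p * ‖a - b‖ ^ p) := by ring
      _ ≤ 1 / 2 + δ * ε := key
      _ = (c ^ p * S) * (1 / 2 + δ * ε) := by rw [hcp, one_mul]
      _ = _ := by ring

variable {α : Type*} [MeasurableSpace α] {μ : Measure α}

theorem norm_rpow_eq_integral {F : Type*} [NormedAddCommGroup F] {p : ℝ} (hp : 0 < p)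
    (f : Lp F (ENNReal.ofReal p) μ) :
    ‖f‖ ^ p = ∫ x, ‖f x‖ ^ p ∂μ := by
  have h := (Lp.memLp f).eLpNorm_eq_integral_rpow_norm (by simpa using hp) (by simp)
  rw [ENNReal.toReal_ofReal hp.le] at h
  have h0 : 0 ≤ ∫ x, ‖f x‖ ^ p ∂μ := integral_nonneg fun x => Real.rpow_nonneg (norm_nonneg _) _
  rw [Lp.norm_def, h, ENNReal.toReal_ofReal (Real.rpow_nonneg h0 _), ← Real.rpow_mul h0,
    inv_mul_cancel₀ hp.ne', Real.rpow_one]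

theorem integrable_norm_rpow {F : Type*} [NormedAddCommGroup F] {p : ℝ} (hp : 0 < p)
    (f : Lp F (ENNReal.ofReal p) μ) :
    Integrable (fun x => ‖f x‖ ^ p) μ := by
  have h := (Lp.memLp f).integrable_norm_rpow (by simpa using hp) (by simp)
  rwa [ENNReal.toReal_ofReal hp.le] at h

theorem uniformConvexSpace_Lp [FiniteDimensional ℝ F] [StrictConvexSpace ℝ F] {p : ℝ}
    (hp : 1 < p) [Fact (1 ≤ ENNReal.ofReal p)] :
    UniformConvexSpace (Lp F (ENNReal.ofReal p) μ) := by
  have hp0 : 0 < p := by linarith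
  refine ⟨fun η hη => ?_⟩
  have hηp : 0 < η ^ p := Real.rpow_pos_of_pos hη p
  obtain ⟨δ, hδ, h⟩ := exists_norm_half_add_rpow_add_le (F := F) hp (show 0 < η ^ p / 4 by linarith)
  set θ := 1 - δ * η ^ p / 2 with hθ
  have hθ1 : θ < 1 := by have := mul_pos hδ hηp; linarith
  have main : ∀ f g : Lp F (ENNReal.ofReal p) μ, ‖f‖ = 1 → ‖g‖ = 1 → η ≤ ‖f - g‖ →
      ‖(1 / 2 : ℝ) • (f + g)‖ ^ p ≤ θ := by
    intro f g hf hg hfg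
    have key : ∫ x, (‖((1 / 2 : ℝ) • (f + g)) x‖ ^ p + δ * ‖(f - g) x‖ ^ p) ∂μ
        ≤ ∫ x, (1 / 2 + δ * (η ^ p / 4)) * (‖f x‖ ^ p + ‖g x‖ ^ p) ∂μ := by
      refine integral_mono_ae
        ((integrable_norm_rpow hp0 _).add ((integrable_norm_rpow hp0 _).const_mul _))
        (((integrable_norm_rpow hp0 _).add (integrable_norm_rpow hp0 _)).const_mul _) ?_
      filter_upwards [Lp.coeFn_smul (1 / 2 : ℝ) (f + g), Lp.coeFn_add f g, Lp.coeFn_sub f g]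
        with x h1 h2 h3
      rw [h1, Pi.smul_apply, h2, h3]
      exact h (f x) (g x)
    rw [integral_add (integrable_norm_rpow hp0 _) ((integrable_norm_rpow hp0 _).const_mul _),
      integral_const_mul, integral_const_mul,
      integral_add (integrable_norm_rpow hp0 _) (integrable_norm_rpow hp0 _),
      ← norm_rpow_eq_integral hp0, ← norm_rpow_eq_integral hp0, ← norm_rpow_eq_integral hp0,
      ← norm_rpow_eq_integral hp0, hf, hg, Real.one_rpow] at key
    have h4 : η ^ p ≤ ‖f - g‖ ^ p := Real.rpow_le_rpow hη.le hfg hp0.le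
    nlinarith
  refine ⟨2 * (1 - (max θ 0) ^ p⁻¹), ?_, fun f hf g hg hfg => ?_⟩
  · have : (max θ 0) ^ p⁻¹ < 1 :=
      Real.rpow_lt_one (le_max_right _ _) (max_lt hθ1 one_pos) (inv_pos.2 hp0)
    linarith
  · have h1 := (main f g hf hg hfg).trans (le_max_left θ 0)
    have h2 := Real.rpow_le_rpow (Real.rpow_nonneg (norm_nonneg _) _) h1 (inv_nonneg.2 hp0.le)
    rw [Real.rpow_rpow_inv (norm_nonneg _) hp0.ne', norm_smul,
      Real.norm_of_nonneg (by norm_num)] at h2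
    linarith

end UniformConvexity

section WeakConvergence

variable {X Y : Type*} [NormedAddCommGroup X] [NormedSpace ℝ X]
  [NormedAddCommGroup Y] [NormedSpace ℝ Y]

theorem uniformConvexSpace_of_norm_map {X Y : Type*} [NormedAddCommGroup X]
    [NormedAddCommGroup Y] [UniformConvexSpace Y] (L : X →+ Y)
    (hL : ∀ x, ‖L x‖ = ‖x‖) : UniformConvexSpace X := by
  refine ⟨fun ε hε => ?_⟩
  obtain ⟨δ, hδ, h⟩ := exists_forall_sphere_dist_add_le_two_sub Y hε
  refine ⟨δ, hδ, fun x hx y hy hxy => ?_⟩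
  have := h (x := L x) ((hL x).trans hx) (y := L y) ((hL y).trans hy)
    (by rwa [← map_sub, hL])
  rwa [← map_add, hL] at this

/-- In a uniformly convex Banach space, a decreasing sequence of nonempty closed convex sets that
meet a fixed ball has a common point. -/
theorem nonempty_iInter_of_convex [CompleteSpace X] [UniformConvexSpace X] {C : ℕ → Set X}
    (hanti : Antitone C) (hcl : ∀ n, IsClosed (C n)) (hconv : ∀ n, Convex ℝ (C n)) {R : ℝ}
    (hR : ∀ n, ∃ x ∈ C n, ‖x‖ ≤ R) : (⋂ n, C n).Nonempty := by
  set d : ℕ → ℝ := fun n => Metric.infDist 0 (C n)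
  have hne : ∀ n, (C n).Nonempty := fun n => let ⟨x, hx, _⟩ := hR n; ⟨x, hx⟩
  have hdle : ∀ n, ∀ x ∈ C n, d n ≤ ‖x‖ := fun n x hx => by
    simpa using Metric.infDist_le_dist_of_mem (x := (0 : X)) hx
  have hmono : Monotone d := fun m n hmn => Metric.infDist_le_infDist_of_subset (hanti hmn) (hne n)
  have hbdd : BddAbove (Set.range d) := by
    refine ⟨R, ?_⟩
    rintro _ ⟨n, rfl⟩
    obtain ⟨x, hx, hxR⟩ := hR n
    exact (hdle n x hx).trans hxR
  have hlim := tendsto_atTop_ciSup hmono hbdd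
  set D := ⨆ n, d n
  have hdD : ∀ n, d n ≤ D := le_ciSup hbdd
  have hD0 : 0 ≤ D := Metric.infDist_nonneg.trans (hdD 0)
  have hex : ∀ n : ℕ, ∃ x ∈ C n, ‖x‖ < d n + 1 / ((n : ℝ) + 1) := fun n => by
    obtain ⟨x, hx, h⟩ := (Metric.infDist_lt_iff (hne n)).1
      (lt_add_of_pos_right (d n) (Nat.one_div_pos_of_nat (α := ℝ) (n := n)))
    exact ⟨x, hx, by simpa using h⟩
  choose x hxC hxn using hex
  set r : ℕ → ℝ := fun n => D + 1 / ((n : ℝ) + 1)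
  have hr : ∀ n, 0 < r n := fun n => add_pos_of_nonneg_of_pos hD0 Nat.one_div_pos_of_nat
  have hrlim : Tendsto r atTop (𝓝 D) := by
    simpa only [add_zero] using
      (tendsto_const_nhds (x := D)).add (tendsto_one_div_add_atTop_nhds_zero_nat (𝕜 := ℝ))
  have hxr : ∀ n m, n ≤ m → ‖x m‖ ≤ r n := fun n m h => by
    refine (hxn m).le.trans (add_le_add (hdD m) ?_)
    exact Nat.one_div_le_one_div h
  have hsum : ∀ n m, n ≤ m → 2 * d n ≤ ‖x n + x m‖ := fun n m h => by
    have h1 := hdle n _ (hconv n (hxC n) (hanti h (hxC m)) (show (0 : ℝ) ≤ 1 / 2 by norm_num)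
      (show (0 : ℝ) ≤ 1 / 2 by norm_num) (by norm_num))
    rw [← smul_add, norm_smul, Real.norm_of_nonneg (by norm_num)] at h1
    linarith
  have hcau : CauchySeq x := by
    refine Metric.cauchySeq_iff'.2 fun ε hε => ?_
    rcases hD0.eq_or_lt with hD | hD
    · have : ∀ᶠ n in atTop, r n < ε / 2 := hrlim.eventually_lt_const (by rw [← hD]; linarith)
      obtain ⟨n, hn⟩ := this.exists
      refine ⟨n, fun m hm => ?_⟩
      rw [dist_eq_norm]
      have := norm_sub_le (x m) (x n)
      have := hxr n m hm
      have := hxr n n le_rfl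
      linarith
    · obtain ⟨δ, hδ, h⟩ := exists_forall_closed_ball_dist_add_le_two_sub X
        (show 0 < ε / (D + 1) by positivity)
      have : ∀ᶠ n in atTop, (2 - δ) * r n < 2 * d n := by
        refine (hrlim.const_mul (2 - δ)).eventually_lt (hlim.const_mul 2) ?_
        nlinarith
      obtain ⟨n, hn⟩ := this.exists
      refine ⟨n, fun m hm => ?_⟩
      rw [dist_eq_norm, norm_sub_rev]
      by_contra! hc
      have hrn := hr n
      have hrD : r n ≤ D + 1 := by
        have : 1 / ((n : ℝ) + 1) ≤ 1 := by
          rw [div_le_one (by positivity)]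
          linarith [(Nat.cast_nonneg n : (0 : ℝ) ≤ n)]
        simp only [r]
        linarith
      have hs : ∀ y : X, ‖(r n)⁻¹ • y‖ = ‖y‖ / r n := fun y => by
        rw [norm_smul, Real.norm_of_nonneg (inv_nonneg.2 hrn.le), div_eq_inv_mul]
      have := h (x := (r n)⁻¹ • x n) (by rw [hs, div_le_one hrn]; exact hxr n n le_rfl)
        (y := (r n)⁻¹ • x m) (by rw [hs, div_le_one hrn]; exact hxr n m hm) (by
          rw [← smul_sub, hs]
          exact div_le_div₀ (norm_nonneg _) hc hrn hrD)
      rw [← smul_add, hs, div_le_iff₀ hrn] at this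
      linarith [hsum n m hm]
  obtain ⟨a, ha⟩ := cauchySeq_tendsto_of_complete hcau
  refine ⟨a, Set.mem_iInter.2 fun n => (hcl n).mem_of_tendsto ha ?_⟩
  filter_upwards [eventually_ge_atTop n] with m hm using hanti hm (hxC m)

/-- A bounded sequence in a uniformly convex Banach space whose image under an injective bounded
operator converges to zero is weakly null. -/
theorem tendsto_dual_of_tendsto_map [CompleteSpace X] [UniformConvexSpace X] (i : X →L[ℝ] Y)
    (hi : Function.Injective i) {v : ℕ → X} {R : ℝ} (hv : ∀ k, ‖v k‖ ≤ R)
    (hiv : Tendsto (fun k => ‖i (v k)‖) atTop (𝓝 0)) (f : X →L[ℝ] ℝ) :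
    Tendsto (fun k => f (v k)) atTop (𝓝 0) := by
  have upper : ∀ f : X →L[ℝ] ℝ, ∀ ε > 0, ∀ᶠ k in atTop, f (v k) < ε := by
    intro f ε hε
    by_contra hcon
    have hfreq : ∃ᶠ k in atTop, ε ≤ f (v k) := by
      simpa only [Filter.not_eventually, not_lt] using hcon
    set C : ℕ → Set X := fun n => {x | ε ≤ f x} ∩ {x | ∀ η, (∀ k ≥ n, ‖i (v k)‖ ≤ η) → ‖i x‖ ≤ η}
    have hCeq : ∀ n, C n = {x | ε ≤ f x} ∩
        ⋂ (η : ℝ) (_ : ∀ k ≥ n, ‖i (v k)‖ ≤ η), i ⁻¹' Metric.closedBall 0 η := by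
      intro n
      ext x
      simp [C]
    have hne : (⋂ n, C n).Nonempty := by
      refine nonempty_iInter_of_convex (R := R) ?_ ?_ ?_ ?_
      · exact fun m n hmn x hx => ⟨hx.1, fun η h => hx.2 η fun k hk => h k (hmn.trans hk)⟩
      · intro n
        rw [hCeq]
        refine (isClosed_le continuous_const f.continuous).inter ?_
        exact isClosed_biInter fun η _ => Metric.isClosed_closedBall.preimage i.continuous
      · intro n
        rw [hCeq]
        refine (convex_halfSpace_ge f.toLinearMap.isLinear ε).inter ?_
        exact convex_iInter₂ fun η _ =>
          (convex_closedBall (0 : Y) η).linear_preimage i.toLinearMap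
      · intro n
        obtain ⟨k, hk, hkε⟩ := (frequently_atTop.1 hfreq) n
        exact ⟨v k, ⟨hkε, fun η h => h k hk⟩, hv k⟩
    obtain ⟨w, hw⟩ := hne
    have hw' := Set.mem_iInter.1 hw
    have hi0 : i w = 0 := by
      rw [← norm_le_zero_iff]
      refine le_of_forall_pos_le_add fun η hη => ?_
      obtain ⟨n, hn⟩ := eventually_atTop.1 (hiv.eventually_lt_const hη)
      rw [zero_add]
      exact (hw' n).2 η fun k hk => (hn k hk).le
    have hw0 : w = 0 := hi (by rw [hi0, map_zero])
    have : ε ≤ f w := (hw' 0).1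
    rw [hw0, map_zero] at this
    linarith
  refine Metric.tendsto_nhds.2 fun ε hε => ?_
  filter_upwards [upper f ε hε, upper (-f) ε hε] with k h1 h2
  rw [dist_zero_right, Real.norm_eq_abs, abs_lt]
  simp only [neg_apply] at h2
  exact ⟨by linarith, h1⟩

theorem tendsto_toWeakSpace_iff {v : ℕ → X} :
    Tendsto (fun k => toWeakSpace ℝ X (v k)) atTop (𝓝 0) ↔
      ∀ f : X →L[ℝ] ℝ, Tendsto (fun k => f (v k)) atTop (𝓝 0) := by
  have h := WeakBilin.tendsto_iff_forall_eval_tendsto (topDualPairing ℝ X).flip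
    (f := fun k => toWeakSpace ℝ X (v k)) (l := atTop) (x := 0)
    (fun x y hxy => by
      refine (SeparatingDual.eq_iff_forall_dual_eq (R := ℝ)).2 fun g => ?_
      exact LinearMap.congr_fun hxy g)
  refine h.trans (forall_congr' fun f => ?_)
  change Tendsto (fun k => f (v k)) atTop (𝓝 (f 0)) ↔ _
  rw [map_zero]

/-- A weakly null sequence is bounded. -/
theorem exists_norm_le_of_weakNull {v : ℕ → X}
    (h : ∀ f : X →L[ℝ] ℝ, Tendsto (fun k => f (v k)) atTop (𝓝 0)) : ∃ R, ∀ k, ‖v k‖ ≤ R := by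
  obtain ⟨R, hR⟩ := banach_steinhaus
    (g := fun k => NormedSpace.inclusionInDoubleDual ℝ X (v k)) fun f => by
      obtain ⟨C, hC⟩ := (h f).norm.bddAbove_range
      exact ⟨C, fun k => hC ⟨k, rfl⟩⟩
  exact ⟨R, fun k => ((NormedSpace.inclusionInDoubleDualLi ℝ (E := X)).norm_map (v k)).symm.trans_le
    (hR k)⟩

end WeakConvergence

section Pairing

variable {α F : Type*} [MeasurableSpace α] {μ : Measure α} [NormedAddCommGroup F] [NormedSpace ℝ F]
  {p q : ℝ≥0∞} [Fact (1 ≤ p)] [Fact (1 ≤ q)] [p.HolderConjugate q]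

/-- The functional `w ↦ ∫ h(x)(w(x)) dμ(x)` on `L^q`, for `h ∈ L^p` with `p` and `q` conjugate. -/
def integralPairing {h : α → F →L[ℝ] ℝ} (hh : MemLp h p μ) : Lp F q μ →L[ℝ] ℝ :=
  ContinuousLinearMap.lpPairing μ p q (ContinuousLinearMap.id ℝ (F →L[ℝ] ℝ)) hh.toLp

theorem integralPairing_apply {h : α → F →L[ℝ] ℝ} (hh : MemLp h p μ) (w : Lp F q μ) :
    integralPairing hh w = ∫ x, h x (w x) ∂μ := by
  rw [integralPairing, ContinuousLinearMap.lpPairing_eq_integral]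
  refine integral_congr_ae ?_
  filter_upwards [hh.coeFn_toLp] with x hx
  rw [hx]
  rfl

end Pairing

section WeakGradient

theorem holderConjugate_ofReal {p : ℝ} (hp : 1 < p) :
    (ENNReal.ofReal (p / (p - 1))).HolderConjugate (ENNReal.ofReal p) := 
  (Real.HolderConjugate.conjExponent hp).symm.ennrealOfReal

theorem one_le_ofReal_conjExponent {p : ℝ} (hp : 1 < p) :
    Fact (1 ≤ ENNReal.ofReal (p / (p - 1))) :=
  ⟨by
    rw [ENNReal.one_le_ofReal, one_le_div (by linarith)]
    linarith⟩

variable {N : ℕ} {p : ℝ} [Fact (1 < p)] [Fact (p < N)]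

/-- The second component of an element of `D^{1,p}` is the weak gradient of the first one. -/
theorem integral_mul_grad {w : LCrit N p × LGrad N p} (hw : w ∈ (testGraph N p).topologicalClosure)
    {ψ : Euc N → ℝ} (hψ : ContDiff ℝ ∞ ψ) (hc : HasCompactSupport ψ) (v : Euc N) :
    ∫ x, ψ x * w.2 x v = - ∫ x, fderiv ℝ ψ x v * w.1 x := by
  have hp : 1 < p := Fact.out
  have hq : 1 < critExp N p := Fact.out
  have := holderConjugate_ofReal hp
  have := holderConjugate_ofReal hq
  have := one_le_ofReal_conjExponent hp
  have := one_le_ofReal_conjExponent hq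
  have hψ' : Continuous fun x => fderiv ℝ ψ x v :=
    (hψ.continuous_fderiv (by simp)).clm_apply continuous_const
  have hcψ' : HasCompactSupport fun x => fderiv ℝ ψ x v := 
    hc.fderiv_apply ℝ v
  let A : Euc N → (Euc N →L[ℝ] ℝ) →L[ℝ] ℝ := fun x => ψ x • ContinuousLinearMap.apply ℝ ℝ v
  let B : Euc N → ℝ →L[ℝ] ℝ := fun x => fderiv ℝ ψ x v • ContinuousLinearMap.id ℝ ℝ
  have hA : MemLp A (ENNReal.ofReal (p / (p - 1))) volume :=
    Continuous.memLp_of_hasCompactSupport (f := A)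
      (Continuous.smul hψ.continuous continuous_const) hc.smul_right
  have hB : MemLp B (ENNReal.ofReal (critExp N p / (critExp N p - 1))) volume :=
    Continuous.memLp_of_hasCompactSupport (f := B)
      (Continuous.smul hψ' continuous_const) hcψ'.smul_right
  have hcl : IsClosed {w : LCrit N p × LGrad N p |
      integralPairing hA w.2 = - integralPairing hB w.1} :=
    isClosed_eq (by fun_prop) (by fun_prop)
  have hmem := closure_minimal (s := (testGraph N p : Set _)) ?_ hcl hw
  · have h : integralPairing hA w.2 = - integralPairing hB w.1 := hmem
    rw [integralPairing_apply, integralPairing_apply] at h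
    exact h
  · rintro w ⟨φ, hφ, hcφ, e1, e2⟩
    change integralPairing hA w.2 = - integralPairing hB w.1
    rw [integralPairing_apply, integralPairing_apply]
    have i1 : ∫ x, A x (w.2 x) = ∫ x, ψ x * fderiv ℝ φ x v := integral_congr_ae (by
      filter_upwards [e2] with x hx
      rw [hx]
      rfl)
    have i2 : ∫ x, B x (w.1 x) = ∫ x, fderiv ℝ ψ x v * φ x := integral_congr_ae (by
      filter_upwards [e1] with x hx
      rw [hx]
      rfl)
    have hφ' : Continuous fun x => fderiv ℝ φ x v :=
      (hφ.continuous_fderiv (by simp)).clm_apply continuous_const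
    rw [i1, i2]
    refine integral_mul_fderiv_eq_neg_fderiv_mul_of_integrable ?_ ?_ ?_ ?_ ?_
    · exact (hψ'.mul hφ.continuous).integrable_of_hasCompactSupport hcψ'.mul_right
    · exact (hψ.continuous.mul hφ').integrable_of_hasCompactSupport hc.mul_right
    · exact (hψ.continuous.mul hφ.continuous).integrable_of_hasCompactSupport hc.mul_right
    · exact fun x _ => hψ.differentiable (by simp) x
    · exact fun x _ => hφ.differentiable (by simp) x

theorem D1p.pair_mem (u : D1p N p) : D1p.pair u ∈ (testGraph N p).topologicalClosure :=
  Subtype.property (p := (· ∈ (testGraph N p).topologicalClosure)) u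

theorem sobolevEmbedding_injective : Function.Injective (sobolevEmbedding N p) := by
  refine (injective_iff_map_eq_zero _).2 fun u hu => D1p.grad_injective ?_
  rw [map_zero]
  have hfn : (D1p.pair u).1 = 0 := hu
  have hp1 : (1 : ℝ≥0∞) ≤ ENNReal.ofReal p := Fact.out
  have hloc : LocallyIntegrable (D1p.grad u) (volume : Measure (Euc N)) :=
    (Lp.memLp _).locallyIntegrable hp1
  refine Lp.ext ?_
  refine EventuallyEq.trans ?_ (Lp.coeFn_zero _ _ _).symm
  refine ae_eq_zero_of_integral_contDiff_smul_eq_zero hloc fun ψ hψ hc => ?_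
  ext v
  have hint : Integrable (fun x => ψ x • D1p.grad u x) (volume : Measure (Euc N)) :=
    hloc.integrable_smul_left_of_hasCompactSupport hψ.continuous hc
  rw [ContinuousLinearMap.integral_apply hint]
  refine (integral_mul_grad (D1p.pair_mem u) hψ hc v).trans ?_
  rw [hfn]
  change _ = (0 : ℝ)
  rw [neg_eq_zero]
  refine integral_eq_zero_of_ae ?_
  filter_upwards [Lp.coeFn_zero ℝ (ENNReal.ofReal (critExp N p)) (volume : Measure (Euc N))]
    with x hx
  rw [hx]
  simp

theorem radialEmbedding_injective : Function.Injective (radialEmbedding N p) :=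
  sobolevEmbedding_injective.comp Subtype.val_injective

end WeakGradient

section RadialIntegrals

variable {N : ℕ}

theorem lintegral_comp_smul {t : ℝ} (ht : 0 < t) {f : Euc N → ℝ≥0∞} (hf : Measurable f) :
    ∫⁻ x, f (t • x) = ENNReal.ofReal ((t ^ N)⁻¹) * ∫⁻ x, f x := by
  have hmap := Measure.map_addHaar_smul (volume : Measure (Euc N)) ht.ne'
  rw [finrank_euclideanSpace_fin, abs_of_pos (by positivity)] at hmap
  rw [← lintegral_map hf (measurable_const_smul t), hmap, lintegral_smul_measure, smul_eq_mul]

theorem setLIntegral_norm_rpow_smul {S : Set (Euc N)} (hS : MeasurableSet S) (m : ℝ) {r : ℝ}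
    (hr : 0 < r) :
    ∫⁻ y in {y | r⁻¹ • y ∈ S}, ENNReal.ofReal (‖y‖ ^ (-m))
      = ENNReal.ofReal (r ^ (N - m)) * ∫⁻ y in S, ENNReal.ofReal (‖y‖ ^ (-m)) := by
  have hf : Measurable (S.indicator fun y : Euc N => ENNReal.ofReal (‖y‖ ^ (-m))) :=
    (ENNReal.measurable_ofReal.comp (measurable_norm.pow_const _)).indicator hS
  have h := lintegral_comp_smul (inv_pos.2 hr) hf
  have hm : MeasurableSet {y : Euc N | r⁻¹ • y ∈ S} := measurable_const_smul r⁻¹ hS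
  have hpt : ∀ y : Euc N, S.indicator (fun y : Euc N => ENNReal.ofReal (‖y‖ ^ (-m))) (r⁻¹ • y)
      = ENNReal.ofReal (r ^ m) *
        {y : Euc N | r⁻¹ • y ∈ S}.indicator (fun y => ENNReal.ofReal (‖y‖ ^ (-m))) y := by
    intro y
    by_cases hy : r⁻¹ • y ∈ S
    · rw [Set.indicator_of_mem hy, Set.indicator_of_mem (by exact hy),
        ← ENNReal.ofReal_mul (by positivity), norm_smul, Real.norm_of_nonneg (by positivity),
        Real.mul_rpow (by positivity) (norm_nonneg _), Real.inv_rpow hr.le, Real.rpow_neg hr.le,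
        inv_inv]
    · rw [Set.indicator_of_notMem hy, Set.indicator_of_notMem (by exact hy), mul_zero]
  simp only [hpt] at h
  rw [lintegral_const_mul' _ _ ENNReal.ofReal_ne_top, lintegral_indicator hm,
    lintegral_indicator hS] at h
  have h2 := congrArg (fun z => ENNReal.ofReal (r ^ (-m)) * z) h
  simp only [← mul_assoc] at h2
  rw [← ENNReal.ofReal_mul (by positivity), ← ENNReal.ofReal_mul (by positivity),
    ← Real.rpow_add hr, neg_add_cancel, Real.rpow_zero, ENNReal.ofReal_one, one_mul] at h2
  rw [h2]
  congr 2
  rw [inv_pow, inv_inv, ← Real.rpow_natCast, ← Real.rpow_add hr]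
  congr 1
  ring

theorem exists_setLIntegral_outer_le [Nontrivial (Euc N)] {m : ℝ} (hm : N < m) :
    ∃ C : ℝ≥0, ∀ r > 0, ∫⁻ y in {y : Euc N | r < ‖y‖}, ENNReal.ofReal (‖y‖ ^ (-m))
      ≤ C * ENNReal.ofReal (r ^ (N - m)) := by
  have hN : 1 ≤ N := by
    have := Module.finrank_pos (R := ℝ) (M := Euc N)
    rwa [finrank_euclideanSpace_fin] at this
  have hS : MeasurableSet {y : Euc N | 1 < ‖y‖} := measurableSet_lt measurable_const measurable_norm
  have hfin : ∫⁻ y in {y : Euc N | 1 < ‖y‖}, ENNReal.ofReal (‖y‖ ^ (-m)) < ⊤ := by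
    have h1 : IntegrableOn (fun y : Euc N => ‖y‖ ^ (-m)) {y : Euc N | 1 < ‖y‖} := by
      have h2 : Integrable (fun y : Euc N => (Set.Ioi (1 : ℝ)).indicator (fun t => t ^ (-m)) ‖y‖) := by
        refine (integrable_fun_norm_addHaar volume
          (f := (Set.Ioi (1 : ℝ)).indicator fun t => t ^ (-m))).2 ?_
        rw [finrank_euclideanSpace_fin]
        have h3 : IntegrableOn (fun t : ℝ => t ^ ((N : ℝ) - 1 - m)) (Set.Ioi 1) :=
          integrableOn_Ioi_rpow_of_lt (by linarith) one_pos
        refine ((integrable_indicator_iff measurableSet_Ioi).2 h3).integrableOn.congr ?_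
        refine Eventually.of_forall fun t => ?_
        simp only [Set.indicator_apply, smul_eq_mul]
        split_ifs with ht
        · have ht0 : 0 < t := one_pos.trans ht
          rw [← Real.rpow_natCast, ← Real.rpow_add ht0, Nat.cast_sub hN, Nat.cast_one]
          rfl
        · rw [mul_zero]
      refine ((integrable_indicator_iff hS).1 ?_)
      exact h2
    exact (lintegral_ofReal_le_lintegral_enorm _).trans_lt h1.2
  refine ⟨(∫⁻ y in {y : Euc N | 1 < ‖y‖}, ENNReal.ofReal (‖y‖ ^ (-m))).toNNReal, fun r hr => ?_⟩
  rw [ENNReal.coe_toNNReal hfin.ne, mul_comm, ← setLIntegral_norm_rpow_smul hS m hr]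
  refine le_of_eq ?_
  congr 2
  ext y
  simp only [Set.mem_ofPred_eq, norm_smul, norm_inv, Real.norm_of_nonneg hr.le]
  rw [← div_eq_inv_mul, one_lt_div hr]

theorem exists_setLIntegral_inner_le [Nontrivial (Euc N)] {m : ℝ} (hm : m < N) :
    ∃ C : ℝ≥0, ∀ r > 0, ∫⁻ y in {y : Euc N | ‖y‖ < r}, ENNReal.ofReal (‖y‖ ^ (-m))
      ≤ C * ENNReal.ofReal (r ^ (N - m)) := by
  have hN : 1 ≤ N := by
    have := Module.finrank_pos (R := ℝ) (M := Euc N)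
    rwa [finrank_euclideanSpace_fin] at this
  have hS : MeasurableSet {y : Euc N | ‖y‖ < 1} := measurableSet_lt measurable_norm measurable_const
  have hfin : ∫⁻ y in {y : Euc N | ‖y‖ < 1}, ENNReal.ofReal (‖y‖ ^ (-m)) < ⊤ := by
    have h1 : IntegrableOn (fun y : Euc N => ‖y‖ ^ (-m)) (Metric.ball 0 1) := by
      refine (integrableOn_fun_norm_addHaar volume (f := fun t => t ^ (-m))).2 ?_
      rw [finrank_euclideanSpace_fin]
      have h3 : IntegrableOn (fun t : ℝ => t ^ ((N : ℝ) - 1 - m)) (Set.Ioo 0 1) :=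
        (intervalIntegral.integrableOn_Ioo_rpow_iff one_pos).2 (by linarith)
      refine h3.congr_fun (fun t ht => ?_) measurableSet_Ioo
      simp only [smul_eq_mul]
      rw [← Real.rpow_natCast, ← Real.rpow_add ht.1, Nat.cast_sub hN, Nat.cast_one]
      rfl
    have hball : {y : Euc N | ‖y‖ < 1} = Metric.ball 0 1 := by ext; simp
    rw [hball]
    exact (lintegral_ofReal_le_lintegral_enorm _).trans_lt h1.2
  refine ⟨(∫⁻ y in {y : Euc N | ‖y‖ < 1}, ENNReal.ofReal (‖y‖ ^ (-m))).toNNReal, fun r hr => ?_⟩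
  rw [ENNReal.coe_toNNReal hfin.ne, mul_comm, ← setLIntegral_norm_rpow_smul hS m hr]
  refine le_of_eq ?_
  congr 2
  ext y
  simp only [Set.mem_ofPred_eq, norm_smul, norm_inv, Real.norm_of_nonneg hr.le]
  rw [← div_eq_inv_mul, div_lt_one hr]

end RadialIntegrals

section Hardy

variable {N : ℕ} [Nontrivial (Euc N)] {p : ℝ}

/-- A weighted Hölder estimate on the complement of a ball. -/
theorem exists_rpow_setLIntegral_outer_le (hp : 1 < p) {b : ℝ} (hb : 1 - N / p < b) :
    ∃ C : ℝ≥0, ∀ r > 0, ∀ g : Euc N → ℝ≥0∞, AEMeasurable g →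
      (∫⁻ y in {y : Euc N | r < ‖y‖}, g y * ENNReal.ofReal (‖y‖ ^ (1 - N : ℝ))) ^ p
        ≤ C * ENNReal.ofReal (r ^ (p - b * p - N)) *
          ∫⁻ y in {y : Euc N | r < ‖y‖}, g y ^ p * ENNReal.ofReal (‖y‖ ^ (b * p)) := by
  have hp0 : 0 < p := by linarith
  have hpq := Real.HolderConjugate.conjExponent hp
  set q := p.conjExponent with hq
  have hq0 : 0 < q := hpq.symm.pos
  have hqe : q = p / (p - 1) := rfl
  have hp1 : 0 < p - 1 := by linarith
  have hm : (N : ℝ) < (N - 1 + b) * q := by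
    rw [hqe, mul_div_assoc', lt_div_iff₀ hp1]
    have := mul_lt_mul_of_pos_right hb hp0
    rw [sub_mul, div_mul_cancel₀ _ hp0.ne'] at this
    nlinarith
  obtain ⟨C, hC⟩ := exists_setLIntegral_outer_le (N := N) hm
  refine ⟨C ^ (p - 1), fun r hr g hg => ?_⟩
  set S := {y : Euc N | r < ‖y‖}
  have hS : MeasurableSet S := measurableSet_lt measurable_const measurable_norm
  have hmeas : ∀ a : ℝ, Measurable fun y : Euc N => ENNReal.ofReal (‖y‖ ^ a) := fun a =>
    ENNReal.measurable_ofReal.comp (measurable_norm.pow_const _)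
  have hpos : ∀ y ∈ S, 0 < ‖y‖ := fun y hy => hr.trans hy
  have hsplit : ∫⁻ y in S, g y * ENNReal.ofReal (‖y‖ ^ (1 - N : ℝ))
      = ∫⁻ y in S, (g y * ENNReal.ofReal (‖y‖ ^ b)) *
          ENNReal.ofReal (‖y‖ ^ (-(N - 1 + b))) := by
    refine setLIntegral_congr_fun hS fun y hy => ?_
    rw [mul_assoc, ← ENNReal.ofReal_mul (by positivity), ← Real.rpow_add (hpos y hy)]
    congr 3
    ring
  have h1 := ENNReal.lintegral_mul_le_Lp_mul_Lq (volume.restrict S) hpq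
    (f := fun y => g y * ENNReal.ofReal (‖y‖ ^ b))
    (g := fun y => ENNReal.ofReal (‖y‖ ^ (-(N - 1 + b))))
    (hg.restrict.mul (hmeas b).aemeasurable) (hmeas _).aemeasurable
  have e1 : ∫⁻ y in S, (g y * ENNReal.ofReal (‖y‖ ^ b)) ^ p
      = ∫⁻ y in S, g y ^ p * ENNReal.ofReal (‖y‖ ^ (b * p)) := by
    refine setLIntegral_congr_fun hS fun y hy => ?_
    rw [ENNReal.mul_rpow_of_nonneg _ _ hp0.le,
      ENNReal.ofReal_rpow_of_nonneg (by positivity) hp0.le, ← Real.rpow_mul (norm_nonneg _)]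
  have e2 : ∫⁻ y in S, ENNReal.ofReal (‖y‖ ^ (-(N - 1 + b))) ^ q
      = ∫⁻ y in S, ENNReal.ofReal (‖y‖ ^ (-((N - 1 + b) * q))) := by
    refine setLIntegral_congr_fun hS fun y hy => ?_
    rw [ENNReal.ofReal_rpow_of_nonneg (by positivity) hq0.le, ← Real.rpow_mul (norm_nonneg _),
      neg_mul]
  rw [e1, e2] at h1
  simp only [Pi.mul_apply] at h1
  rw [hsplit]
  calc _ ≤ ((∫⁻ y in S, g y ^ p * ENNReal.ofReal (‖y‖ ^ (b * p))) ^ (1 / p) *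
        (C * ENNReal.ofReal (r ^ (N - (N - 1 + b) * q))) ^ (1 / q)) ^ p := by
        refine ENNReal.rpow_le_rpow (h1.trans ?_) hp0.le
        gcongr
        exact hC r hr
    _ = _ := by
        rw [ENNReal.mul_rpow_of_nonneg _ _ hp0.le, ← ENNReal.rpow_mul, ← ENNReal.rpow_mul,
          one_div_mul_cancel hp0.ne', ENNReal.rpow_one, mul_comm]
        have hexp : 1 / q * p = p - 1 := by rw [hqe]; field_simp
        rw [hexp, ENNReal.mul_rpow_of_nonneg _ _ hp1.le,
          ENNReal.ofReal_rpow_of_nonneg (by positivity) hp1.le, ← Real.rpow_mul hr.le,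
          ENNReal.coe_rpow_of_nonneg _ hp1.le]
        congr 4
        rw [hqe]
        field_simp
        ring

/-- Hardy's inequality, with the function bounded by a potential of its gradient. -/
theorem exists_hardy_le (hp : 1 < p) (hpN : p < N) :
    ∃ C : ℝ≥0, ∀ g : Euc N → ℝ≥0∞, AEMeasurable g →
      ∫⁻ x : Euc N, ENNReal.ofReal (‖x‖ ^ (-p)) *
        (∫⁻ y in {y : Euc N | ‖x‖ < ‖y‖}, g y * ENNReal.ofReal (‖y‖ ^ (1 - N : ℝ))) ^ p
        ≤ C * ∫⁻ y, g y ^ p := by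
  have hp0 : 0 < p := by linarith
  set b : ℝ := (1 - N / p) / 2 with hbdef
  have hneg : 1 - N / p < 0 := by rw [sub_neg, one_lt_div hp0]; exact hpN
  have hb1 : 1 - N / p < b := by linarith
  have hb0 : b * p < 0 := mul_neg_of_neg_of_pos (by linarith) hp0
  obtain ⟨C, hC⟩ := exists_rpow_setLIntegral_outer_le (N := N) hp hb1
  obtain ⟨K, hK⟩ := exists_setLIntegral_inner_le (N := N) (m := b * p + N) (by linarith)
  refine ⟨C * K, fun g hg => ?_⟩
  have hmeas : ∀ a : ℝ, Measurable fun y : Euc N => ENNReal.ofReal (‖y‖ ^ a) := fun a =>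
    ENNReal.measurable_ofReal.comp (measurable_norm.pow_const _)
  have hne : ∀ᵐ x : Euc N, x ≠ 0 := Measure.ae_ne volume 0
  let G : Euc N → Euc N → ℝ≥0∞ := fun x y => {z : Euc N × Euc N | ‖z.1‖ < ‖z.2‖}.indicator
    (fun z => g z.2 ^ p * ENNReal.ofReal (‖z.2‖ ^ (b * p)) *
      ENNReal.ofReal (‖z.1‖ ^ (-(b * p + N)))) (x, y)
  have hG : AEMeasurable (Function.uncurry G) (volume.prod volume) := by
    refine AEMeasurable.indicator ?_
      (measurableSet_lt measurable_fst.norm measurable_snd.norm)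
    refine AEMeasurable.mul (AEMeasurable.mul ?_ ?_) ?_
    · exact (hg.comp_quasiMeasurePreserving Measure.quasiMeasurePreserving_snd).pow_const p
    · exact ((hmeas _).comp measurable_snd).aemeasurable
    · exact ((hmeas _).comp measurable_fst).aemeasurable
  calc _ ≤ ∫⁻ x : Euc N, C * ∫⁻ y, G x y := by
        refine lintegral_mono_ae ?_
        filter_upwards [hne] with x hx
        have hx0 : 0 < ‖x‖ := norm_pos_iff.2 hx
        refine (mul_le_mul_right (hC ‖x‖ hx0 g hg) _).trans (le_of_eq ?_)
        have hS : MeasurableSet {y : Euc N | ‖x‖ < ‖y‖} :=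
          measurableSet_lt measurable_const measurable_norm
        have hGx : ∫⁻ y, G x y = ENNReal.ofReal (‖x‖ ^ (-(b * p + N))) *
            ∫⁻ y in {y : Euc N | ‖x‖ < ‖y‖}, g y ^ p * ENNReal.ofReal (‖y‖ ^ (b * p)) := by
          rw [← lintegral_const_mul' _ _ ENNReal.ofReal_ne_top, ← lintegral_indicator hS]
          refine lintegral_congr fun y => ?_
          simp only [G, Set.indicator_apply, Set.mem_ofPred_eq]
          split_ifs
          · ring
          · rfl
        have hexp : -(b * p + N) = -p + (p - b * p - N) := by ring
        rw [hGx, hexp, Real.rpow_add hx0, ENNReal.ofReal_mul (by positivity)]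
        ring
    _ = C * ∫⁻ y, ∫⁻ x, G x y := by
        rw [lintegral_const_mul' _ _ ENNReal.coe_ne_top, lintegral_lintegral_swap hG]
    _ ≤ C * ∫⁻ y, K * g y ^ p := by
        refine mul_le_mul_right (lintegral_mono_ae ?_) _
        filter_upwards [hne] with y hy
        have hy0 : 0 < ‖y‖ := norm_pos_iff.2 hy
        have hS : MeasurableSet {x : Euc N | ‖x‖ < ‖y‖} :=
          measurableSet_lt measurable_norm measurable_const
        have hGy : ∫⁻ x, G x y = (∫⁻ x in {x : Euc N | ‖x‖ < ‖y‖},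
            ENNReal.ofReal (‖x‖ ^ (-(b * p + N)))) *
              (g y ^ p * ENNReal.ofReal (‖y‖ ^ (b * p))) := by
          rw [← lintegral_mul_const _ (hmeas _), ← lintegral_indicator hS]
          refine lintegral_congr fun x => ?_
          simp only [G, Set.indicator_apply, Set.mem_ofPred_eq]
          split_ifs
          · ring
          · rfl
        rw [hGy]
        refine (mul_le_mul_left (hK ‖y‖ hy0) _).trans (le_of_eq ?_)
        rw [mul_assoc, mul_left_comm (ENNReal.ofReal _), ← ENNReal.ofReal_mul (by positivity),
          ← Real.rpow_add hy0]
        rw [show (N : ℝ) - (b * p + N) + b * p = 0 by ring, Real.rpow_zero, ENNReal.ofReal_one,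
          mul_one]
    _ = _ := by
        rw [lintegral_const_mul' _ _ ENNReal.coe_ne_top, ENNReal.coe_mul, mul_assoc]

end Hardy

section Potential

set_option maxSynthPendingDepth 3

/-- The kernel `y ↦ 1_{r < |y|} |y|^{-N} y`, with `y` acting on covectors by evaluation. -/
def radialKernel (N : ℕ) (r : ℝ) : Euc N → (Euc N →L[ℝ] ℝ) →L[ℝ] ℝ :=
  {y | r < ‖y‖}.indicator fun y => (‖y‖ ^ N)⁻¹ • ContinuousLinearMap.apply ℝ ℝ y

/-- The radial potential `∫_{r < |y|} |y|^{-N} w(y)(y) dy` of a field `w` of covectors. -/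
def radialPotential {N : ℕ} (r : ℝ) (w : Euc N → Euc N →L[ℝ] ℝ) : ℝ :=
  ∫ y, radialKernel N r y (w y)

variable {N : ℕ} {p : ℝ}

theorem radialKernel_apply (r : ℝ) (y : Euc N) (w : Euc N →L[ℝ] ℝ) :
    radialKernel N r y w = {y : Euc N | r < ‖y‖}.indicator (fun y => (‖y‖ ^ N)⁻¹ * w y) y := by
  by_cases hy : r < ‖y‖
  · rw [radialKernel, Set.indicator_of_mem (by exact hy), Set.indicator_of_mem (by exact hy)]
    rfl
  · rw [radialKernel, Set.indicator_of_notMem (by exact hy), Set.indicator_of_notMem (by exact hy)]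
    rfl

theorem measurableSet_norm_gt (r : ℝ) : MeasurableSet {y : Euc N | r < ‖y‖} :=
  measurableSet_lt measurable_const measurable_norm

theorem stronglyMeasurable_radialKernel (r : ℝ) : StronglyMeasurable (radialKernel N r) := by
  refine StronglyMeasurable.indicator ?_ (measurableSet_norm_gt r)
  exact (measurable_norm.pow_const N).inv.stronglyMeasurable.smul
    (ContinuousLinearMap.apply ℝ ℝ : Euc N →L[ℝ] (Euc N →L[ℝ] ℝ) →L[ℝ] ℝ).continuous.stronglyMeasurable

theorem enorm_radialKernel_le {r : ℝ} (hr : 0 < r) (y : Euc N) :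
    ‖radialKernel N r y‖ₑ ≤ {y : Euc N | r < ‖y‖}.indicator
      (fun y => ENNReal.ofReal (‖y‖ ^ (1 - N : ℝ))) y := by
  by_cases hy : r < ‖y‖
  · rw [radialKernel, Set.indicator_of_mem (by exact hy), Set.indicator_of_mem (by exact hy),
      ← ofReal_norm]
    have hy0 : 0 < ‖y‖ := hr.trans hy
    refine ENNReal.ofReal_le_ofReal ?_
    rw [norm_smul, norm_inv, norm_pow, norm_norm, sub_eq_neg_add, Real.rpow_add hy0,
      Real.rpow_one, Real.rpow_neg hy0.le, Real.rpow_natCast]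
    gcongr
    refine ContinuousLinearMap.opNorm_le_bound _ (norm_nonneg _) fun f => ?_
    rw [ContinuousLinearMap.apply_apply, mul_comm]
    exact f.le_opNorm y
  · rw [radialKernel, Set.indicator_of_notMem (by exact hy), Set.indicator_of_notMem (by exact hy)]
    simp

theorem memLp_radialKernel [Nontrivial (Euc N)] (hp : 1 < p) (hpN : p < N) {r : ℝ} (hr : 0 < r) :
    MemLp (radialKernel N r) (ENNReal.ofReal (p / (p - 1))) volume := by
  refine ⟨(stronglyMeasurable_radialKernel r).aestronglyMeasurable, ?_⟩
  have hp1 : 0 < p - 1 := by linarith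
  set q := p / (p - 1) with hq
  have hq0 : 0 < q := div_pos (by linarith) hp1
  have hm : (N : ℝ) < (N - 1) * q := by
    rw [hq, mul_div_assoc', lt_div_iff₀ hp1]
    nlinarith
  obtain ⟨C, hC⟩ := exists_setLIntegral_outer_le hm
  refine (eLpNorm_lt_top_iff_lintegral_rpow_enorm_lt_top (by simpa using hq0) (by simp)).2 ?_
  rw [ENNReal.toReal_ofReal hq0.le]
  refine lt_of_le_of_lt ?_ ((hC r hr).trans_lt
    (ENNReal.mul_lt_top ENNReal.coe_lt_top ENNReal.ofReal_lt_top))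
  rw [← lintegral_indicator (measurableSet_norm_gt r)]
  refine lintegral_mono fun y => ?_
  refine (ENNReal.rpow_le_rpow (enorm_radialKernel_le hr y) hq0.le).trans (le_of_eq ?_)
  by_cases hy : r < ‖y‖
  · rw [Set.indicator_of_mem (by exact hy), Set.indicator_of_mem (by exact hy),
      ENNReal.ofReal_rpow_of_nonneg (by positivity) hq0.le, ← Real.rpow_mul (norm_nonneg _)]
    congr 2
    ring
  · rw [Set.indicator_of_notMem (by exact hy), Set.indicator_of_notMem (by exact hy),
      ENNReal.zero_rpow_of_pos hq0]

theorem enorm_radialPotential_le {r : ℝ} (hr : 0 < r) (w : Euc N → Euc N →L[ℝ] ℝ) :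
    ‖radialPotential r w‖ₑ
      ≤ ∫⁻ y in {y : Euc N | r < ‖y‖}, ‖w y‖ₑ * ENNReal.ofReal (‖y‖ ^ (1 - N : ℝ)) := by
  refine (enorm_integral_le_lintegral_enorm _).trans ?_
  rw [← lintegral_indicator (measurableSet_norm_gt r)]
  refine lintegral_mono fun y => ?_
  refine ((radialKernel N r y).le_opENorm (w y)).trans ?_
  refine (mul_le_mul_left (enorm_radialKernel_le hr y) _).trans (le_of_eq ?_)
  simp only [Set.indicator_apply]
  split_ifs
  · exact mul_comm _ _
  · exact zero_mul _

theorem enorm_radialKernel_sub_le {c r s : ℝ} (hr : c ≤ r) (hs : c ≤ s) (y : Euc N) :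
    ‖radialKernel N r y - radialKernel N s y‖ₑ ≤ ‖radialKernel N c y‖ₑ := by
  simp only [radialKernel, Set.indicator_apply, Set.mem_ofPred_eq]
  split_ifs <;> first | (exfalso; linarith) | simp

/-- The behaviour of the radial potential under dilations. -/
theorem radialPotential_lpDilateLin (a : ℝ) {t : ℝ} (ht : 0 < t) (r : ℝ) (w : LGrad N p) :
    radialPotential r (lpDilateLin (Euc N →L[ℝ] ℝ) (ENNReal.ofReal p) (a * t) ht w)
      = a * radialPotential (t * r) w := by
  have h1 : radialPotential r (lpDilateLin (Euc N →L[ℝ] ℝ) (ENNReal.ofReal p) (a * t) ht w)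
      = ∫ y : Euc N, (a * t ^ N) * (fun z => radialKernel N (t * r) z (w z)) (t • y) := by
    refine integral_congr_ae ?_
    filter_upwards [lpDilateLin_coeFn (ENNReal.ofReal p) (a * t) ht w] with y hy
    rw [hy]
    simp only [radialKernel_apply, Set.indicator_apply, Set.mem_ofPred_eq, norm_smul,
      Real.norm_of_nonneg ht.le, mul_lt_mul_iff_right₀ ht]
    split_ifs with hlt
    · rw [smul_apply, map_smul, smul_eq_mul, smul_eq_mul, mul_pow, mul_inv]
      field_simp
    · rw [mul_zero]
  rw [h1, integral_const_mul, Measure.integral_comp_smul volume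
    (fun z => radialKernel N (t * r) z (w z)) t, finrank_euclideanSpace_fin, abs_of_pos (by positivity), smul_eq_mul,
    radialPotential]
  field_simp

/-- The radial potential at radius `r`, as a bounded functional on `L^p`. -/
def radialFunctional [Fact (1 < p)] [Fact (p < N)] [Nontrivial (Euc N)] {r : ℝ} (hr : 0 < r) :
    LGrad N p →L[ℝ] ℝ :=
  have hp : 1 < p := Fact.out
  have := holderConjugate_ofReal hp
  have := one_le_ofReal_conjExponent hp
  integralPairing (memLp_radialKernel hp Fact.out hr)

variable [Fact (1 < p)] [Fact (p < N)] [Nontrivial (Euc N)]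

theorem radialFunctional_apply {r : ℝ} (hr : 0 < r) (w : LGrad N p) :
    radialFunctional hr w = radialPotential r w := by
  have hp : 1 < p := Fact.out
  have := holderConjugate_ofReal hp
  have := one_le_ofReal_conjExponent hp
  exact integralPairing_apply _ w

theorem tendsto_radialFunctional {r : ℕ → ℝ} {s : ℝ} (hr : ∀ n, 0 < r n) (hs : 0 < s)
    (h : Tendsto r atTop (𝓝 s)) :
    Tendsto (fun n => radialFunctional (N := N) (p := p) (hr n)) atTop
      (𝓝 (radialFunctional hs)) := by
  have hp : 1 < p := Fact.out
  have := holderConjugate_ofReal hp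
  have := one_le_ofReal_conjExponent hp
  refine ((ContinuousLinearMap.lpPairing volume (ENNReal.ofReal (p / (p - 1))) (ENNReal.ofReal p)
    (ContinuousLinearMap.id ℝ ((Euc N →L[ℝ] ℝ) →L[ℝ] ℝ))).continuous.tendsto _).comp ?_
  rw [Lp.tendsto_Lp_iff_tendsto_eLpNorm'']
  have hq0 : 0 < p / (p - 1) := div_pos (by linarith) (by linarith)
  simp only [eLpNorm_eq_lintegral_rpow_enorm_toReal (by simpa using hq0) ENNReal.ofReal_ne_top]
  rw [ENNReal.toReal_ofReal hq0.le]
  have hlim : Tendsto (fun n => ∫⁻ y, ‖(radialKernel N (r n) - radialKernel N s) y‖ₑ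
      ^ (p / (p - 1))) atTop (𝓝 0) := by
    have hs2 : 0 < s / 2 := by linarith
    have hfin := (eLpNorm_lt_top_iff_lintegral_rpow_enorm_lt_top (by simpa using hq0) (by simp)).1
      (memLp_radialKernel hp (Fact.out : p < N) hs2).2
    rw [ENNReal.toReal_ofReal hq0.le] at hfin
    have hev : ∀ᶠ n in atTop, s / 2 ≤ r n := h.eventually (eventually_ge_nhds (by linarith))
    have := tendsto_lintegral_filter_of_dominated_convergence (l := atTop)
      (F := fun n y => ‖(radialKernel N (r n) - radialKernel N s) y‖ₑ ^ (p / (p - 1)))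
      (f := fun _ => 0) (μ := volume) (fun y => ‖radialKernel N (s / 2) y‖ₑ ^ (p / (p - 1)))
      (Eventually.of_forall fun n => ?_) ?_ hfin.ne ?_
    · simpa using this
    · exact ((stronglyMeasurable_radialKernel _).sub
        (stronglyMeasurable_radialKernel _)).enorm.pow_const _
    · filter_upwards [hev] with n hn
      refine Eventually.of_forall fun y => ENNReal.rpow_le_rpow ?_ hq0.le
      exact enorm_radialKernel_sub_le hn (by linarith) y
    · have hsph : ∀ᵐ y : Euc N, ‖y‖ ≠ s := by
        have := Measure.addHaar_sphere (volume : Measure (Euc N)) 0 s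
        rw [measure_eq_zero_iff_ae_notMem] at this
        filter_upwards [this] with y hy
        simpa using hy
      filter_upwards [hsph] with y hy
      refine tendsto_const_nhds.congr' ?_
      have heq : ∀ᶠ n in atTop, (r n < ‖y‖ ↔ s < ‖y‖) := by
        rcases lt_or_gt_of_ne hy with hlt | hgt
        · filter_upwards [h.eventually_const_lt hlt] with n hn
          exact ⟨fun h' => absurd h' (by linarith), fun h' => absurd h' (by linarith)⟩
        · filter_upwards [h.eventually_lt_const hgt] with n hn
          exact ⟨fun _ => hgt, fun _ => hn⟩
      filter_upwards [heq] with n hn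
      simp [radialKernel, Set.indicator_apply, hn, ENNReal.zero_rpow_of_pos hq0]
  have := hlim.ennrpow_const (1 / (p / (p - 1)))
  rwa [ENNReal.zero_rpow_of_pos (by positivity)] at this

end Potential

section Polar

variable (N : ℕ)

/-- The measure `t^{N-1} dt dθ` on `(0, ∞) × S^{N-1}`. -/
def polarMeasure : Measure (Set.Ioi (0 : ℝ) × Metric.sphere (0 : Euc N) 1) :=
  (Measure.volumeIoiPow (N - 1)).prod (volume : Measure (Euc N)).toSphere

/-- Polar coordinates `(t, θ) ↦ tθ`. -/
def polarMap (z : Set.Ioi (0 : ℝ) × Metric.sphere (0 : Euc N) 1) : Euc N := (z.1 : ℝ) • (z.2 : Euc N)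

variable {N}

theorem norm_polarMap (z : Set.Ioi (0 : ℝ) × Metric.sphere (0 : Euc N) 1) :
    ‖polarMap N z‖ = z.1 := by
  have h1 : ‖(z.2 : Euc N)‖ = 1 := by simp
  rw [polarMap, norm_smul, h1, mul_one, Real.norm_of_nonneg (le_of_lt z.1.2)]

theorem polarMap_eq : polarMap N =
    Subtype.val ∘ (homeomorphUnitSphereProd (Euc N)).symm ∘ Prod.swap := by
  ext1 z
  simp [polarMap]

theorem measurableEmbedding_polarMap : MeasurableEmbedding (polarMap N) := by
  rw [polarMap_eq]
  refine (MeasurableEmbedding.subtype_coe (measurableSet_singleton _).compl).comp ?_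
  exact ((homeomorphUnitSphereProd (Euc N)).symm.measurableEmbedding).comp
    MeasurableEquiv.prodComm.measurableEmbedding

theorem measurePreserving_polarMap [Nontrivial (Euc N)] :
    MeasurePreserving (polarMap N) (polarMeasure N) volume := by
  rw [polarMap_eq]
  have h1 := (Measure.measurePreserving_homeomorphUnitSphereProd (volume : Measure (Euc N)))
  rw [finrank_euclideanSpace_fin] at h1
  have h2 : MeasurePreserving (homeomorphUnitSphereProd (Euc N)).symm _ _ :=
    MeasurePreserving.symm (homeomorphUnitSphereProd (Euc N)).toMeasurableEquiv h1
  have h3 : MeasurePreserving (Subtype.val : ({(0)}ᶜ : Set (Euc N)) → Euc N)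
      ((volume : Measure (Euc N)).comap Subtype.val) volume := by
    refine ⟨measurable_subtype_coe, ?_⟩
    rw [map_comap_subtype_coe (measurableSet_singleton _).compl, restrict_compl_singleton]
  exact h3.comp (h2.comp Measure.measurePreserving_swap)

theorem integral_volumeIoiPow (n : ℕ) (f : ℝ → ℝ) :
    ∫ t, f t ∂(Measure.volumeIoiPow n) = ∫ t in Set.Ioi (0 : ℝ), t ^ n * f t := by
  simp only [Measure.volumeIoiPow, ENNReal.ofReal]
  rw [integral_withDensity_eq_integral_smul,
    integral_subtype_comap measurableSet_Ioi fun a ↦ Real.toNNReal (a ^ n) • f a,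
    setIntegral_congr_fun measurableSet_Ioi fun x hx ↦ ?_]
  · rw [NNReal.smul_def, Real.coe_toNNReal _ (pow_nonneg (le_of_lt hx) _), smul_eq_mul]
  · exact (measurable_subtype_coe.pow_const _).real_toNNReal

end Polar

section SphericalMean

set_option maxSynthPendingDepth 3

variable {N : ℕ}

theorem integral_Ioi_fderiv_smul {φ : Euc N → ℝ} (h : ContDiff ℝ ∞ φ) (hc : HasCompactSupport φ)
    (θ : Metric.sphere (0 : Euc N) 1) (s : ℝ) :
    ∫ t in Set.Ioi s, fderiv ℝ φ (t • (θ : Euc N)) θ = - φ (s • (θ : Euc N)) := by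
  have hθ : ‖(θ : Euc N)‖ = 1 := by simp
  have hemb : IsClosedEmbedding fun t : ℝ => t • (θ : Euc N) := by
    refine Isometry.isClosedEmbedding ?_
    refine Isometry.of_dist_eq fun a b => ?_
    rw [dist_eq_norm, ← sub_smul, norm_smul, hθ, mul_one, dist_eq_norm]
  have hd : ∀ t : ℝ, HasDerivAt (fun t : ℝ => φ (t • (θ : Euc N)))
      (fderiv ℝ φ (t • (θ : Euc N)) θ) t := fun t => by
    have h1 := (h.differentiable (by simp) (t • (θ : Euc N))).hasFDerivAt.comp_hasDerivAt t
      ((hasDerivAt_id t).smul_const (θ : Euc N))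
    rw [one_smul] at h1
    exact h1
  have hc1 : HasCompactSupport fun t : ℝ => φ (t • (θ : Euc N)) := hc.comp_isClosedEmbedding hemb
  have hc2 : HasCompactSupport fun t : ℝ => fderiv ℝ φ (t • (θ : Euc N)) θ :=
    (hc.fderiv_apply ℝ (θ : Euc N)).comp_isClosedEmbedding hemb
  have hcont : Continuous fun t : ℝ => fderiv ℝ φ (t • (θ : Euc N)) θ :=
    ((h.continuous_fderiv (by simp)).comp (by fun_prop)).clm_apply continuous_const
  have hcont1 : Continuous fun t : ℝ => φ (t • (θ : Euc N)) := h.continuous.comp (by fun_prop)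
  have := integral_Ioi_of_hasDerivAt_of_tendsto' (a := s) (m := 0)
    (fun t _ => hd t) (hcont.integrable_of_hasCompactSupport hc2).integrableOn ?_
  · rw [this, zero_sub]
  · have h0 := hc1.is_zero_at_infty
    exact h0.mono_left atTop_le_cocompact

/-- The spherical means of a test function are the radial potentials of its derivative. -/
theorem integral_sphere_eq_radialPotential [Nontrivial (Euc N)] {φ : Euc N → ℝ}
    (h : ContDiff ℝ ∞ φ) (hc : HasCompactSupport φ) {s : ℝ} (hs : 0 < s) :
    ∫ θ, φ (s • (θ : Euc N)) ∂(volume : Measure (Euc N)).toSphere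
      = - radialPotential s (fderiv ℝ φ) := by
  have hN : 1 ≤ N := by
    have := Module.finrank_pos (R := ℝ) (M := Euc N)
    rwa [finrank_euclideanSpace_fin] at this
  have hint : Integrable (fun y : Euc N => radialKernel N s y (fderiv ℝ φ y)) := by
    have hd : Continuous (fderiv ℝ φ) := h.continuous_fderiv (by simp)
    have hb : Integrable fun y : Euc N => (s ^ N)⁻¹ * ‖fderiv ℝ φ y y‖ :=
      (((hd.clm_apply continuous_id).norm).integrable_of_hasCompactSupport
        ((hc.fderiv (𝕜 := ℝ)).mono' (fun y hy => subset_closure (by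
          intro h0; exact hy (by simp [h0]))))).const_mul _
    refine hb.mono' ?_ ?_
    · simp only [radialKernel_apply]
      refine AEStronglyMeasurable.congr (f := {y : Euc N | s < ‖y‖}.indicator
        fun y => (‖y‖ ^ N)⁻¹ * fderiv ℝ φ y y) ?_ (Eventually.of_forall fun y => rfl)
      refine AEStronglyMeasurable.indicator ?_ (measurableSet_norm_gt s)
      exact ((measurable_norm.pow_const N).inv.mul
        (hd.clm_apply continuous_id).measurable).aestronglyMeasurable
    · refine Eventually.of_forall fun y => ?_
      rw [radialKernel_apply]
      simp only [Set.indicator_apply, Set.mem_ofPred_eq]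
      split_ifs with hy
      · rw [norm_mul, norm_inv, norm_pow, norm_norm]
        gcongr
      · rw [norm_zero]
        positivity
  have hpol := measurePreserving_polarMap (N := N)
  have hint' := (hpol.integrable_comp_emb measurableEmbedding_polarMap).2 hint
  rw [radialPotential, ← hpol.integral_comp measurableEmbedding_polarMap, polarMeasure,
    integral_prod_symm _ (by exact hint'), ← integral_neg]
  refine integral_congr_ae (Eventually.of_forall fun θ => ?_)
  have hθ : ‖(θ : Euc N)‖ = 1 := by simp
  have e1 := integral_volumeIoiPow (N - 1) fun t => radialKernel N s (t • (θ : Euc N))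
    (fderiv ℝ φ (t • (θ : Euc N)))
  have e2 : ∫ t in Set.Ioi (0 : ℝ), t ^ (N - 1) * radialKernel N s (t • (θ : Euc N))
      (fderiv ℝ φ (t • (θ : Euc N))) = ∫ t in Set.Ioi s, fderiv ℝ φ (t • (θ : Euc N)) θ := by
    have hsub : Set.Ioi s = Set.Ioi (0 : ℝ) ∩ Set.Ioi s :=
      (Set.inter_eq_right.2 (Set.Ioi_subset_Ioi hs.le)).symm
    rw [hsub, ← setIntegral_indicator measurableSet_Ioi]
    refine setIntegral_congr_fun measurableSet_Ioi fun t ht => ?_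
    have ht0 : 0 < t := ht
    simp only [radialKernel_apply, Set.indicator_apply, Set.mem_ofPred_eq, norm_smul, hθ,
      Real.norm_of_nonneg ht0.le, mul_one, Set.mem_Ioi]
    split_ifs
    · rw [map_smul, smul_eq_mul]
      obtain ⟨n, rfl⟩ : ∃ n, N = n + 1 := ⟨N - 1, by omega⟩
      rw [Nat.add_sub_cancel]
      field_simp
      ring
    · rw [mul_zero]
  simp only [polarMap]
  rw [e1, e2, integral_Ioi_fderiv_smul h hc, neg_neg]

end SphericalMean

section Representation

theorem enorm_rpow_eq_lintegral {α F : Type*} [MeasurableSpace α] {μ : Measure α}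
    [NormedAddCommGroup F] {p : ℝ} (hp : 0 < p) (f : Lp F (ENNReal.ofReal p) μ) :
    ‖f‖ₑ ^ p = ∫⁻ x, ‖f x‖ₑ ^ p ∂μ := by
  rw [Lp.enorm_def, eLpNorm_eq_lintegral_rpow_enorm_toReal (by simpa using hp)
    ENNReal.ofReal_ne_top, ENNReal.toReal_ofReal hp.le, ← ENNReal.rpow_mul,
    one_div_mul_cancel hp.ne', ENNReal.rpow_one]

/-- Convergence of integrals over a finite measure from convergence in `L^q`. -/
theorem tendsto_integral_of_tendsto_lintegral_rpow {α : Type*} [MeasurableSpace α] {μ : Measure α}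
    [IsFiniteMeasure μ] {q : ℝ} (hq : 1 ≤ q) {F : ℕ → α → ℝ} (hF : ∀ n, Integrable (F n) μ) (c : ℝ)
    (h : Tendsto (fun n => ∫⁻ x, ‖F n x - c‖ₑ ^ q ∂μ) atTop (𝓝 0)) :
    Tendsto (fun n => ∫ x, F n x ∂μ) atTop (𝓝 (μ.real Set.univ * c)) := by
  have hq0 : 0 < q := by linarith
  have h1 : Tendsto (fun n => ∫⁻ x, ‖F n x - c‖ₑ ∂μ) atTop (𝓝 0) := by
    have hle : ∀ n, ∫⁻ x, ‖F n x - c‖ₑ ∂μ ≤ (∫⁻ x, ‖F n x - c‖ₑ ^ q ∂μ) ^ (1 / q) *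
        μ Set.univ ^ (1 - 1 / q) := fun n => by
      have := eLpNorm_le_eLpNorm_mul_rpow_measure_univ (μ := μ) (p := 1) (q := ENNReal.ofReal q)
        (by simpa using hq) (f := fun x => F n x - c)
        ((hF n).1.sub aestronglyMeasurable_const)
      rwa [eLpNorm_one_eq_lintegral_enorm, eLpNorm_eq_lintegral_rpow_enorm_toReal
        (by simpa using hq0) ENNReal.ofReal_ne_top, ENNReal.toReal_ofReal hq0.le,
        ENNReal.toReal_one, one_div_one] at this
    have hlim := ENNReal.Tendsto.mul_const (b := μ Set.univ ^ (1 - 1 / q)) (h.ennrpow_const (1 / q))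
      (.inr (ENNReal.rpow_ne_top_of_nonneg (by
        rw [sub_nonneg, div_le_one hq0]; exact hq) (measure_ne_top _ _)))
    rw [ENNReal.zero_rpow_of_pos (by positivity), zero_mul] at hlim
    exact tendsto_of_tendsto_of_tendsto_of_le_of_le tendsto_const_nhds hlim (fun _ => zero_le) hle
  have := tendsto_integral_of_L1 (fun _ : α => c) aestronglyMeasurable_const
    (Eventually.of_forall hF) h1
  rwa [integral_const, smul_eq_mul] at this

variable {N : ℕ} {p : ℝ} [Fact (1 < p)] [Fact (p < N)]

theorem exists_testGraph_dist_lt (u : D1p N p) {ε : ℝ} (hε : 0 < ε) :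
    ∃ w ∈ testGraph N p, ‖w - D1p.pair u‖ < ε := by
  obtain ⟨w, hw, h⟩ := Metric.mem_closure_iff.1 (D1p.pair_mem u) ε hε
  exact ⟨w, hw, by rwa [← dist_eq_norm, dist_comm]⟩

variable [Nontrivial (Euc N)]

/-- A radial element of `D^{1,p}` is the radial potential of its gradient, up to a constant. -/
theorem radial_ae_eq_radialPotential {u : D1p N p} (hu : u ∈ radial N p) :
    sobolevEmbedding N p u =ᵐ[volume] fun x =>
      -((volume : Measure (Euc N)).toSphere.real Set.univ)⁻¹ *
        radialPotential ‖x‖ (D1p.grad u) := by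
  obtain ⟨f, hf⟩ := hu
  have hQ : 1 < critExp N p := Fact.out
  have hQ0 : 0 < critExp N p := by linarith
  set Q := critExp N p
  choose w hw hwu using fun n : ℕ => exists_testGraph_dist_lt u
    (show (0 : ℝ) < (1 / 2) ^ n by positivity)
  choose φ hφ hc e1 e2 using hw
  set σ := (volume : Measure (Euc N)).toSphere with hσ
  have hpol := measurePreserving_polarMap (N := N)
  let U : Euc N → ℝ := sobolevEmbedding N p u
  have hUm : AEStronglyMeasurable U volume := Lp.aestronglyMeasurable (sobolevEmbedding N p u)
  have hFm : ∀ n, AEMeasurable (fun x => ‖φ n x - U x‖ₑ ^ Q) volume := fun n =>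
    ((hφ n).continuous.aestronglyMeasurable.sub hUm).enorm.pow_const _
  have hFm' : ∀ n, AEMeasurable (fun z => ‖φ n (polarMap N z) - U (polarMap N z)‖ₑ ^ Q)
      (polarMeasure N) := fun n => 
    (hFm n).comp_quasiMeasurePreserving hpol.quasiMeasurePreserving
  have hFle : ∀ n, ∫⁻ x, ‖φ n x - U x‖ₑ ^ Q ≤ (2 : ℝ≥0∞)⁻¹ ^ n := fun n => by
    have hn1 : ‖(w n).1 - sobolevEmbedding N p u‖ ≤ (1 / 2) ^ n :=
      (norm_fst_le (w n - D1p.pair u)).trans (hwu n).le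
    have hn2 : ‖(w n).1 - sobolevEmbedding N p u‖ₑ ≤ (2 : ℝ≥0∞)⁻¹ ^ n := by
      rw [← ofReal_norm]
      refine (ENNReal.ofReal_le_ofReal hn1).trans (le_of_eq ?_)
      rw [ENNReal.ofReal_pow (by norm_num), one_div, ENNReal.ofReal_inv_of_pos (by norm_num)]
      simp
    have hle1 : (2 : ℝ≥0∞)⁻¹ ^ n ≤ 1 := pow_le_one₀ zero_le (by simp)
    calc ∫⁻ x, ‖φ n x - U x‖ₑ ^ Q = ∫⁻ x, ‖((w n).1 - sobolevEmbedding N p u) x‖ₑ ^ Q := by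
          refine lintegral_congr_ae ?_
          filter_upwards [e1 n, Lp.coeFn_sub (w n).1 (sobolevEmbedding N p u)] with x h1 h2
          rw [h2, Pi.sub_apply, h1]
      _ = ‖(w n).1 - sobolevEmbedding N p u‖ₑ ^ Q := (enorm_rpow_eq_lintegral hQ0 _).symm
      _ ≤ ‖(w n).1 - sobolevEmbedding N p u‖ₑ :=
          ENNReal.rpow_le_self_of_le_one (hn2.trans hle1) hQ.le
      _ ≤ _ := hn2
  let E : ℕ → Set.Ioi (0 : ℝ) → ℝ≥0∞ := fun n t =>
    ∫⁻ θ, ‖φ n (polarMap N (t, θ)) - U (polarMap N (t, θ))‖ₑ ^ Q ∂σ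
  have hEm : ∀ n, AEMeasurable (E n) (Measure.volumeIoiPow (N - 1)) := fun n =>
    AEMeasurable.lintegral_prod_right' (hFm' n)
  have hEle : ∀ n, ∫⁻ t, E n t ∂(Measure.volumeIoiPow (N - 1)) ≤ (2 : ℝ≥0∞)⁻¹ ^ n := fun n => by
    refine le_of_eq_of_le ?_ (hFle n)
    rw [← hpol.lintegral_comp_emb measurableEmbedding_polarMap, polarMeasure]
    exact (lintegral_prod _ (hFm' n)).symm
  have hElim : ∀ᵐ t ∂(Measure.volumeIoiPow (N - 1)), Tendsto (fun n => E n t) atTop (𝓝 0) := by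
    have hfin : ∫⁻ t, ∑' n, E n t ∂(Measure.volumeIoiPow (N - 1)) ≠ ⊤ := by
      rw [lintegral_tsum hEm]
      refine ne_top_of_le_ne_top ?_ (ENNReal.tsum_le_tsum hEle)
      rw [ENNReal.tsum_geometric]
      simp
    filter_upwards [ae_lt_top' (AEMeasurable.tsum hEm) hfin] with t ht
    exact ENNReal.tendsto_atTop_zero_of_tsum_ne_top ht.ne
  have hfpol : ∀ᵐ z ∂(polarMeasure N), U (polarMap N z) = f z.1 := by
    filter_upwards [hpol.quasiMeasurePreserving.ae hf] with z hz
    rw [← norm_polarMap z]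
    exact hz
  have hgrad : Tendsto (fun n => (w n).2) atTop (𝓝 (D1p.grad u)) := by
    refine tendsto_iff_norm_sub_tendsto_zero.2 (squeeze_zero (fun _ => norm_nonneg _)
      (fun n => (norm_snd_le (w n - D1p.pair u)).trans (hwu n).le) ?_)
    exact tendsto_pow_atTop_nhds_zero_of_lt_one (by norm_num) (by norm_num)
  have hσpos : σ.real Set.univ ≠ 0 := by
    rw [hσ, Measure.toSphere_real_apply_univ]
    refine mul_ne_zero (Nat.cast_ne_zero.2 Module.finrank_pos.ne') ?_
    exact (ENNReal.toReal_pos (Metric.measure_ball_pos _ _ one_pos).ne' measure_ball_lt_top.ne).ne'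
  have hrep : ∀ᵐ t : Set.Ioi (0 : ℝ) ∂(Measure.volumeIoiPow (N - 1)),
      f t = -(σ.real Set.univ)⁻¹ * radialPotential t (D1p.grad u) := by
    filter_upwards [hElim, Measure.ae_ae_of_ae_prod hfpol] with t ht1 ht2
    have ht0 : (0 : ℝ) < t := t.2
    have hconv : Tendsto (fun n => ∫⁻ θ, ‖φ n ((t : ℝ) • (θ : Euc N)) - f t‖ₑ ^ Q ∂σ) atTop
        (𝓝 0) := by
      refine ht1.congr fun n => lintegral_congr_ae ?_
      filter_upwards [ht2] with θ hθ
      rw [hθ]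
      rfl
    have hint : ∀ n, Integrable (fun θ : Metric.sphere (0 : Euc N) 1 =>
        φ n ((t : ℝ) • (θ : Euc N))) σ := fun n => by
      have hcont : Continuous fun θ : Metric.sphere (0 : Euc N) 1 => φ n ((t : ℝ) • (θ : Euc N)) :=
        (hφ n).continuous.comp (by fun_prop)
      exact hcont.integrable_of_hasCompactSupport (HasCompactSupport.of_compactSpace _)
    have hl1 := tendsto_integral_of_tendsto_lintegral_rpow hQ.le hint (f t) hconv
    have hl2 : Tendsto (fun n => ∫ θ, φ n ((t : ℝ) • (θ : Euc N)) ∂σ) atTop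
        (𝓝 (-radialPotential t (D1p.grad u))) := by
      rw [← radialFunctional_apply ht0]
      refine (((radialFunctional ht0).continuous.tendsto _).comp hgrad).neg.congr fun n => ?_
      rw [Function.comp_apply, radialFunctional_apply, hσ,
        integral_sphere_eq_radialPotential (hφ n) (hc n) ht0]
      congr 1
      refine integral_congr_ae ?_
      filter_upwards [e2 n] with y hy
      rw [hy]
    have := tendsto_nhds_unique hl1 hl2
    field_simp
    linarith
  have hpolrep : ∀ᵐ z ∂(polarMeasure N), U (polarMap N z) =
      -(σ.real Set.univ)⁻¹ * radialPotential ‖polarMap N z‖ (D1p.grad u) := by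
    filter_upwards [hfpol, Measure.quasiMeasurePreserving_fst.ae hrep] with z h1 h2
    rw [h1, h2, norm_polarMap]
  have := (measurableEmbedding_polarMap (N := N)).ae_map_iff (μ := polarMeasure N)
    (p := fun x => U x = -(σ.real Set.univ)⁻¹ * radialPotential ‖x‖ (D1p.grad u))
  rw [hpol.map_eq] at this
  exact this.2 hpolrep

end Representation

section Cocompactness

set_option maxSynthPendingDepth 3

variable {N : ℕ} {p : ℝ}

theorem uniformConvexSpace_dual_euc : UniformConvexSpace (Euc N →L[ℝ] ℝ) :=
  uniformConvexSpace_of_norm_map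
    (InnerProductSpace.toDual ℝ (Euc N)).symm.toLinearEquiv.toAddEquiv.toAddMonoidHom
    fun x => (InnerProductSpace.toDual ℝ (Euc N)).symm.norm_map x

variable [Fact (1 < p)] [Fact (p < N)]

theorem nontrivial_euc (N : ℕ) (p : ℝ) [h : Fact (1 < p)] [h' : Fact (p < N)] :
    Nontrivial (Euc N) := by
  have hN : 0 < N := by
    have h1 := h.out
    have h2 := h'.out
    exact_mod_cast (show (0 : ℝ) < N by linarith)
  have : Nonempty (Fin N) := ⟨⟨0, hN⟩⟩
  infer_instance

/-- The gradient as an isometry from `D^{1,p}_rad` to `L^p`. -/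
def radialGrad (N : ℕ) (p : ℝ) [Fact (1 < p)] [Fact (p < N)] : D1pRad N p →ₗᵢ[ℝ] LGrad N p where
  toLinearMap := D1p.grad ∘ₗ (radial N p).subtype
  norm_map' _ := rfl

theorem uniformConvexSpace_radial : UniformConvexSpace (D1pRad N p) := by
  have := uniformConvexSpace_dual_euc (N := N)
  have : UniformConvexSpace (LGrad N p) := uniformConvexSpace_Lp Fact.out
  exact uniformConvexSpace_of_norm_map (radialGrad N p).toLinearMap.toAddMonoidHom
    (radialGrad N p).norm_map

theorem norm_radialEmbedding_gauge {γ : ℝ} (hγ : 1 < γ) (j : ℤ) (u : D1pRad N p) :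
    ‖radialEmbedding N p (gauge N p hγ j u)‖ = ‖radialEmbedding N p u‖ := by
  have h0 : 0 < γ := zero_lt_one.trans hγ
  have h1 : 1 < p := Fact.out
  have h2 : p < N := Fact.out
  have hQ : 1 < critExp N p := Fact.out
  have h := norm_lpDilateLin (ENNReal.ofReal (critExp N p)) (γ ^ j)
    (Real.rpow_pos_of_pos h0 (p * j / (N - p))) (radialEmbedding N p u)
  refine Eq.trans h ?_
  rw [abs_of_pos (by positivity), ENNReal.toReal_ofReal (by linarith)]
  have : γ ^ j * ((γ ^ (p * j / (N - p))) ^ N)⁻¹ ^ (critExp N p)⁻¹ = 1 := by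
    rw [← Real.rpow_intCast, ← Real.rpow_natCast, ← Real.rpow_mul h0.le, ← Real.rpow_neg h0.le,
      ← Real.rpow_mul h0.le, ← Real.rpow_add h0, critExp]
    have hn : (N : ℝ) - p ≠ 0 := by linarith
    have hN : (N : ℝ) ≠ 0 := by linarith
    have hp : p ≠ 0 := by linarith
    convert Real.rpow_zero γ using 2
    field_simp
    ring
  rw [this, one_mul]

theorem radialPotential_gauge {γ : ℝ} (hγ : 1 < γ) (j : ℤ) (r : ℝ) (u : D1pRad N p) :
    radialPotential r (radialGrad N p (gauge N p hγ j u))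
      = γ ^ j * radialPotential (γ ^ (p * j / (N - p)) * r) (radialGrad N p u) :=
  radialPotential_lpDilateLin (γ ^ j)
    (Real.rpow_pos_of_pos (zero_lt_one.trans hγ) (p * j / (N - p))) r (radialGrad N p u)

/-- The critical norm of a radial element is controlled by a weighted supremum and the norm. -/
theorem exists_norm_radialEmbedding_rpow_le (N : ℕ) (p : ℝ) [Fact (1 < p)] [Fact (p < N)] :
    ∃ C : ℝ≥0, ∀ u : D1pRad N p, ∀ ε > 0,
      (∀ r > 0, r ^ ((N - p) / p) * |radialPotential r (radialGrad N p u)| ≤ ε) →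
        ‖radialEmbedding N p u‖ ^ critExp N p ≤ C * ε ^ (critExp N p - p) * ‖u‖ ^ p := by
  have hp : 1 < p := Fact.out
  have hpN : p < N := Fact.out
  have hp0 : 0 < p := by linarith
  have hNp : 0 < (N : ℝ) - p := by linarith
  have hQ : 1 < critExp N p := Fact.out
  have := nontrivial_euc N p
  set Q := critExp N p with hQdef
  have hQ0 : 0 < Q := by linarith
  have hQp : (N - p) / p * (Q - p) = p := by
    rw [hQdef, critExp]
    field_simp
    ring
  have hQp0 : 0 < Q - p := by
    by_contra! hcon
    have := mul_nonpos_of_nonneg_of_nonpos (div_pos hNp hp0).le hcon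
    linarith
  obtain ⟨H, hH⟩ := exists_hardy_le (N := N) hp hpN
  set κ : ℝ := -((volume : Measure (Euc N)).toSphere.real Set.univ)⁻¹ with hκ
  refine ⟨‖κ‖₊ ^ Q * H, fun u ε hε hu => ?_⟩
  set w := radialGrad N p u
  have key : ‖radialEmbedding N p u‖ₑ ^ Q
      ≤ ‖κ‖ₑ ^ Q * (ENNReal.ofReal (ε ^ (Q - p)) * (H * ‖w‖ₑ ^ p)) := by
    rw [enorm_rpow_eq_lintegral hQ0, enorm_rpow_eq_lintegral hp0 w]
    calc _ ≤ ∫⁻ x : Euc N, ‖κ‖ₑ ^ Q * (ENNReal.ofReal (ε ^ (Q - p)) *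
          (ENNReal.ofReal (‖x‖ ^ (-p)) * (∫⁻ y in {y : Euc N | ‖x‖ < ‖y‖},
            ‖w y‖ₑ * ENNReal.ofReal (‖y‖ ^ (1 - N : ℝ))) ^ p)) := by
          refine lintegral_mono_ae ?_
          filter_upwards [radial_ae_eq_radialPotential u.2, Measure.ae_ne volume 0] with x hx hx0
          have hxpos : 0 < ‖x‖ := norm_pos_iff.2 hx0
          have hx' : radialEmbedding N p u x = κ * radialPotential ‖x‖ w := hx
          rw [hx', enorm_mul, ENNReal.mul_rpow_of_nonneg _ _ hQ0.le]
          refine mul_le_mul_right ?_ _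
          have hsup : ‖radialPotential ‖x‖ w‖ₑ ≤ ENNReal.ofReal (ε * ‖x‖ ^ (-((N - p) / p))) := by
            rw [← ofReal_norm]
            refine ENNReal.ofReal_le_ofReal ?_
            rw [Real.rpow_neg hxpos.le, ← div_eq_mul_inv, le_div_iff₀ (by positivity), mul_comm]
            exact hu _ hxpos
          calc ‖radialPotential ‖x‖ w‖ₑ ^ Q
              = ‖radialPotential ‖x‖ w‖ₑ ^ (Q - p) * ‖radialPotential ‖x‖ w‖ₑ ^ p := by
                rw [← ENNReal.rpow_add_of_nonneg _ _ hQp0.le hp0.le, sub_add_cancel]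
            _ ≤ ENNReal.ofReal (ε * ‖x‖ ^ (-((N - p) / p))) ^ (Q - p) *
                (∫⁻ y in {y : Euc N | ‖x‖ < ‖y‖},
                  ‖w y‖ₑ * ENNReal.ofReal (‖y‖ ^ (1 - N : ℝ))) ^ p := by
                gcongr
                exact enorm_radialPotential_le hxpos w
            _ = _ := by
                rw [ENNReal.ofReal_rpow_of_nonneg (by positivity) hQp0.le,
                  Real.mul_rpow hε.le (by positivity), ← Real.rpow_mul hxpos.le, neg_mul, hQp,
                  ENNReal.ofReal_mul (by positivity), mul_assoc]
      _ ≤ _ := by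
          rw [lintegral_const_mul' _ _ (ENNReal.rpow_ne_top_of_nonneg hQ0.le enorm_ne_top),
            lintegral_const_mul' _ _ ENNReal.ofReal_ne_top]
          gcongr
          exact hH _ (Lp.aestronglyMeasurable w).enorm
  have hfin : ‖κ‖ₑ ^ Q * (ENNReal.ofReal (ε ^ (Q - p)) * (H * ‖w‖ₑ ^ p)) ≠ ⊤ :=
    ENNReal.mul_ne_top (ENNReal.rpow_ne_top_of_nonneg hQ0.le enorm_ne_top)
      (ENNReal.mul_ne_top ENNReal.ofReal_ne_top (ENNReal.mul_ne_top ENNReal.coe_ne_top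
        (ENNReal.rpow_ne_top_of_nonneg hp0.le enorm_ne_top)))
  have := ENNReal.toReal_mono hfin key
  simp only [ENNReal.toReal_mul, ← ENNReal.toReal_rpow, toReal_enorm, ENNReal.coe_toReal] at this
  rw [ENNReal.toReal_ofReal (by positivity), (radialGrad N p).norm_map] at this
  refine this.trans (le_of_eq ?_)
  push_cast
  ring

/-- Radial potentials of a weakly null sequence tend to zero uniformly on compact sets of radii. -/
theorem tendsto_radialPotential_of_weakNull {v : ℕ → D1pRad N p}
    (hv : ∀ f : D1pRad N p →L[ℝ] ℝ, Tendsto (fun k => f (v k)) atTop (𝓝 0)) {a b : ℝ} (ha : 0 < a)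
    {ρ : ℕ → ℝ} (hρ : ∀ k, ρ k ∈ Set.Icc a b) :
    Tendsto (fun k => radialPotential (ρ k) (radialGrad N p (v k))) atTop (𝓝 0) := by
  have := nontrivial_euc N p
  obtain ⟨R, hR⟩ := exists_norm_le_of_weakNull hv
  refine tendsto_of_subseq_tendsto fun ns hns => ?_
  obtain ⟨s, hs, ms, hms, hlim⟩ := isCompact_Icc.tendsto_subseq fun n => hρ (ns n)
  have hs0 : 0 < s := ha.trans_le hs.1
  have hr : ∀ n, 0 < ρ (ns (ms n)) := fun n => ha.trans_le (hρ _).1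
  refine ⟨ms, ?_⟩
  have hL := tendsto_iff_norm_sub_tendsto_zero.1
    (tendsto_radialFunctional (N := N) (p := p) hr hs0 hlim)
  have h1 := (hv ((radialFunctional hs0).comp (radialGrad N p).toContinuousLinearMap)).comp
    (hns.comp hms.tendsto_atTop)
  have h2 := (hL.mul_const R).add h1.norm
  rw [zero_mul, norm_zero, add_zero] at h2
  refine squeeze_zero_norm (fun n => ?_) h2
  rw [← radialFunctional_apply (hr n)]
  have hsplit (L L' : LGrad N p →L[ℝ] ℝ) (x : LGrad N p) : L x = (L - L') x + L' x := by
    rw [sub_apply, sub_add_cancel]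
  rw [hsplit _ (radialFunctional hs0)]
  refine (norm_add_le _ _).trans (add_le_add ?_ le_rfl)
  refine (ContinuousLinearMap.le_opNorm _ _).trans ?_
  gcongr
  rw [(radialGrad N p).norm_map]
  exact hR _

theorem tendsto_weighted_radialPotential {γ : ℝ} (hγ : 1 < γ) {u : ℕ → D1pRad N p}
    (hu : GaugedWeakNull (dilationGroup N p hγ) u) {r : ℕ → ℝ} (hr : ∀ k, 0 < r k) :
    Tendsto (fun k => r k ^ ((N - p) / p) * |radialPotential (r k) (radialGrad N p (u k))|)
      atTop (𝓝 0) := by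
  have h0 : 0 < γ := zero_lt_one.trans hγ
  have hp : 1 < p := Fact.out
  have hpN : p < N := Fact.out
  have hp0 : 0 < p := by linarith
  have hNp : 0 < (N : ℝ) - p := by linarith
  set T := γ ^ (p / (N - p)) with hT
  have hT1 : 1 < T := Real.one_lt_rpow hγ (by positivity)
  have hT0 : 0 < T := by linarith
  have hTj : ∀ j : ℤ, γ ^ (p * j / (N - p)) = T ^ j := fun j => by
    rw [hT, ← Real.rpow_intCast, ← Real.rpow_mul h0.le]
    congr 1
    ring
  have hTα : ∀ j : ℤ, (T ^ j) ^ ((N - p) / p) = γ ^ j := fun j => by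
    rw [← hTj, ← Real.rpow_mul h0.le, ← Real.rpow_intCast]
    congr 1
    field_simp
  choose j hj using fun k => exists_mem_Ico_zpow (hr k) hT1
  set ρ : ℕ → ℝ := fun k => r k / T ^ j k with hρ
  have hρmem : ∀ k, ρ k ∈ Set.Icc 1 T := fun k => by
    have hpos : 0 < T ^ j k := zpow_pos hT0 _
    refine ⟨(one_le_div hpos).2 (hj k).1, (div_le_iff₀ hpos).2 ?_⟩
    rw [mul_comm, ← zpow_add_one₀ hT0.ne']
    exact (hj k).2.le
  have hweak := tendsto_toWeakSpace_iff.1 (hu (fun k => gauge N p hγ (j k)) fun k => ⟨j k, rfl⟩)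
  have hlim := (tendsto_radialPotential_of_weakNull hweak one_pos hρmem).abs.const_mul
    (T ^ ((N - p) / p))
  rw [abs_zero, mul_zero] at hlim
  refine squeeze_zero (fun k => mul_nonneg (Real.rpow_nonneg (hr k).le _) (abs_nonneg _))
    (fun k => ?_) hlim
  have hρ0 : 0 < ρ k := one_pos.trans_le (hρmem k).1
  have hrk : r k = T ^ j k * ρ k := by
    rw [hρ, mul_div_cancel₀ _ (zpow_pos hT0 _).ne']
  calc _ = ρ k ^ ((N - p) / p) *
        |radialPotential (ρ k) (radialGrad N p (gauge N p hγ (j k) (u k)))| := by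
        rw [radialPotential_gauge, hTj, ← hrk, abs_mul, abs_of_pos (zpow_pos h0 _)]
        nth_rw 1 [hrk]
        rw [Real.mul_rpow (zpow_pos hT0 _).le hρ0.le, hTα]
        ring
    _ ≤ _ := by
        gcongr
        exact (hρmem k).2

theorem tendsto_norm_of_gaugedWeakNull {γ : ℝ} (hγ : 1 < γ) {u : ℕ → D1pRad N p}
    (hu : GaugedWeakNull (dilationGroup N p hγ) u) :
    Tendsto (fun k => ‖radialEmbedding N p (u k)‖) atTop (𝓝 0) := by
  have hp : 1 < p := Fact.out
  have hpN : p < N := Fact.out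
  have hp0 : 0 < p := by linarith
  have hQ : 1 < critExp N p := Fact.out
  have hQp : 0 < critExp N p - p := by
    rw [critExp, sub_pos, lt_div_iff₀ (by linarith)]
    nlinarith
  obtain ⟨R, hR⟩ := exists_norm_le_of_weakNull (tendsto_toWeakSpace_iff.1
    (hu (fun _ => ContinuousLinearMap.id ℝ _) fun _ => (dilationGroup N p hγ).id_mem))
  have hR' : ∀ k, ‖u k‖ ≤ R := hR
  have hR0 : 0 ≤ R := (norm_nonneg _).trans (hR' 0)
  obtain ⟨C, hC⟩ := exists_norm_radialEmbedding_rpow_le N p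
  have hsmall : ∀ ε > 0, ∀ᶠ k in atTop, ∀ r > 0,
      r ^ ((N - p) / p) * |radialPotential r (radialGrad N p (u k))| ≤ ε := by
    intro ε hε
    have hch : ∀ k, ∃ r > 0, r ^ ((N - p) / p) * |radialPotential r (radialGrad N p (u k))| ≤ ε →
        ∀ s > 0, s ^ ((N - p) / p) * |radialPotential s (radialGrad N p (u k))| ≤ ε := fun k => by
      by_cases h : ∀ s > 0, s ^ ((N - p) / p) * |radialPotential s (radialGrad N p (u k))| ≤ ε
      · exact ⟨1, one_pos, fun _ => h⟩
      · push Not at h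
        obtain ⟨s, hs, hlt⟩ := h
        exact ⟨s, hs, fun hle => absurd hle hlt.not_ge⟩
    choose r hr0 hr using hch
    filter_upwards [(tendsto_weighted_radialPotential hγ hu hr0).eventually_le_const hε] with k hk
    exact hr k hk
  have hcont : Tendsto (fun ε : ℝ => C * ε ^ (critExp N p - p) * R ^ p) (𝓝[>] 0) (𝓝 0) := by
    have h1 : ContinuousAt (fun ε : ℝ => C * ε ^ (critExp N p - p) * R ^ p) 0 :=
      ((Real.continuousAt_rpow_const 0 _ (.inr hQp.le)).const_mul _).mul_const _
    have h2 := h1.tendsto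
    rw [Real.zero_rpow hQp.ne', mul_zero, zero_mul] at h2
    exact h2.mono_left nhdsWithin_le_nhds
  refine Metric.tendsto_nhds.2 fun η hη => ?_
  obtain ⟨ε, hεlt, hε⟩ := ((hcont.eventually_lt_const
    (Real.rpow_pos_of_pos hη (critExp N p))).and self_mem_nhdsWithin).exists
  have hε0 : (0 : ℝ) < ε := hε
  filter_upwards [hsmall ε hε0] with k hk
  rw [dist_zero_right, norm_norm]
  refine (Real.rpow_lt_rpow_iff (norm_nonneg _) hη.le (by linarith : 0 < critExp N p)).1 ?_
  refine ((hC (u k) ε hε0 hk).trans ?_).trans_lt hεlt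
  gcongr
  exact hR' k

theorem gaugedWeakNull_of_tendsto_norm {γ : ℝ} (hγ : 1 < γ) {u : ℕ → D1pRad N p}
    (hb : Bornology.IsBounded (Set.range u))
    (hu : Tendsto (fun k => ‖radialEmbedding N p (u k)‖) atTop (𝓝 0)) :
    GaugedWeakNull (dilationGroup N p hγ) u := by
  have := uniformConvexSpace_radial (N := N) (p := p)
  obtain ⟨R, hR⟩ := isBounded_iff_forall_norm_le.1 hb
  intro g hg
  choose j hj using hg
  obtain rfl : (fun k => gauge N p hγ (j k)) = g := funext hj
  refine tendsto_toWeakSpace_iff.2 fun f => ?_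
  refine tendsto_dual_of_tendsto_map (R := R) (radialEmbedding N p) radialEmbedding_injective
    (fun k => ?_) ?_ f
  · rw [norm_gauge_apply]
    exact hR _ ⟨k, rfl⟩
  · simpa only [norm_radialEmbedding_gauge] using hu

end Cocompactness

end Cocompact

end

/-- The limiting Sobolev embedding of the radial subspace of `D^{1,p}(ℝ^N)` is cocompact relative
to the discrete group of dilations, and the `L^{p*}` norm metrizes `D`-weak convergence on bounded
sets. -/
theorem proposition2p3 (N : ℕ) (p γ : ℝ) [Fact (1 < p)] [Fact (p < N)] (hγ : 1 < γ) :
    Cocompact.IsCocompactEmbedding (Cocompact.dilationGroup N p hγ)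
        (Cocompact.radialEmbedding N p) ∧
      Cocompact.NormMetrizesGaugedWeak (Cocompact.dilationGroup N p hγ)
        (Cocompact.radialEmbedding N p) :=
  ⟨⟨Cocompact.radialEmbedding_injective, fun _ => Cocompact.tendsto_norm_of_gaugedWeakNull hγ⟩,
    fun _ hb => ⟨Cocompact.tendsto_norm_of_gaugedWeakNull hγ,
      Cocompact.gaugedWeakNull_of_tendsto_norm hγ hb⟩⟩
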